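/- Let $d\ge 2$, let $\mathbb N=\{1,2,\dots\}$, $\mathbb Z_+=\{0,1,2,\dots\}$, and for each $i\in\mathbb Z_+\cup\{\infty\}$ let $p^{(i)}$ be a probability distribution on the $2d$ unit vectors $\{\pm e_j: 1\le j\le d\}$ of $\mathbb Z^d$. For a subgraph $\mathcal Z$ of the nearest-neighbour graph $\mathbb Z^d$ containing the origin, a $p$-random walk on $\mathcal Z$ is the Markov chain started at $0$ which jumps from $x$ to $x+e$ with probability $p(e)\big/\sum_{e':\,(x,x+e')\in\mathcal Z}p(e')$ if $(x,x+e)$ is an edge of $\mathcal Z$, and with probability $0$ otherwise. On a probability space $(\Omega,\mathcal F,\mathbb P)$ let $(X^{(i)})_{i\in\mathbb Z_+\cup\{\infty\}}$ be processes in $\mathbb Z^d$ constructed as follows. Put $\mathcal Z^{(0)}=\mathbb Z^d$. For each $i\in\mathbb Z_+$, given $\mathcal Z^{(i)}$, $X^{(i)}$ is a $p^{(i)}$-random walk on $\mathcal Z^{(i)}$ that is conditionally independent of $(X^{(j)})_{j<i}$, and $\mathcal Z^{(i+1)}$ is the trace of $X^{(i)}$, i.e. the graph whose vertices are the sites visited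 by $X^{(i)}$ and whose (undirected) edges are the edges traversed by $X^{(i)}$. Finally $\mathcal Z^{(\infty)}=\bigcap_{i\in\mathbb Z_+}\mathcal Z^{(i)}$, and, given $\mathcal Z^{(\infty)}$, $X^{(\infty)}$ is a $p^{(\infty)}$-random walk on $\mathcal Z^{(\infty)}$. Let $\delta^{(0)}\in\mathbb R^d$ be given by $\delta^{(0)}_j=p^{(0)}(e_j)-p^{(0)}(-e_j)$, let $\hat\ell^{(i)}\in\mathbb R^d$ be given by $\hat\ell^{(i)}_j=\log\big(p^{(i)}(e_j)/p^{(i)}(-e_j)\big)$, and let $\ell^{(i)}=\hat\ell^{(i)}/\|\hat\ell^{(i)}\|$ with the Euclidean norm (and $\ell^{(i)}=0$ if $\hat\ell^{(i)}=0$). Assume that (a) $\delta^{(0)}_j\ge 0$ for every $j$, and $\delta^{(0)}_1>0$; (b) $p^{(i)}(e)>0$ for every $i\in\mathbb Z_+\cup\{\infty\}$ and every $e\in\{\pm e_j:1\le j\le d\}$. Let $i\in\mathbb N\cup\{\infty\}$ be such that $\delta^{(0)}\cdot\ell^{(i)}\le 0$. Then $X^{(i)}$ is recurrent: $\mathbb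 P$-almost surely, $X^{(i)}$ visits every vertex of $\mathcal Z^{(i)}$ (in particular the origin) infinitely often. -/

import Mathlib

/-- The integer lattice `ℤ^d`. -/
abbrev Site (d : ℕ) : Type := Fin d → ℤ

/-- The unit steps `± e_j`: the pair `(j, 1)` stands for `e_j` and `(j, -1)` for `-e_j`. -/
abbrev Dir (d : ℕ) : Type := Fin d × ℤˣ

/-- The lattice vector `± e_j`. -/
def Dir.vec {d : ℕ} (e : Dir d) : Site d := Pi.single e.1 (e.2 : ℤ)

/-- The nearest-neighbour graph on `ℤ^d`. -/
def latticeGraph (d : ℕ) : SimpleGraph (Site d) where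
  Adj x y := ∑ j, |x j - y j| = 1
  symm := ⟨fun x y h => by simpa only [abs_sub_comm] using h⟩
  loopless := ⟨fun x h => by simp at h⟩

/-- The trace of a path: its vertices are the visited sites and its (undirected) edges are the
traversed nearest-neighbour edges. -/
def traceGraph {d : ℕ} (γ : ℕ → Site d) : (latticeGraph d).Subgraph where
  verts := Set.range γ
  Adj x y := (latticeGraph d).Adj x y ∧ ∃ n, s(γ n, γ (n + 1)) = s(x, y)
  adj_sub h := h.1
  edge_vert := by
    rintro x y ⟨-, n, hn⟩
    rcases Sym2.eq_iff.1 hn with ⟨h, -⟩ | ⟨-, h⟩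
    · exact ⟨n, h⟩
    · exact ⟨n + 1, h⟩
  symm := ⟨fun x y ⟨h, n, hn⟩ => ⟨h.symm, n, hn.trans Sym2.eq_swap⟩⟩

/-- The graphs with a finite index: `Z^(0) = ℤ^d` and `Z^(i+1)` is the trace of the `i`th walk. -/
def finiteGraph {d : ℕ} (γ : ℕ∞ → ℕ → Site d) : ℕ → (latticeGraph d).Subgraph
  | 0 => ⊤
  | i + 1 => traceGraph (γ (i : ℕ∞))

/-- The graphs `Z^(i)`, where `i` is a natural number or `∞`, and `Z^(∞)` is the intersection
of all the others. -/
def walkGraph {d : ℕ} (γ : ℕ∞ → ℕ → Site d) : ℕ∞ → (latticeGraph d).Subgraph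
  | ⊤ => ⨅ i : ℕ, finiteGraph γ i
  | (i : ℕ) => finiteGraph γ i

open Classical in
/-- The probability that a `p`-random walk on `Z` at `x` makes the step `e`. -/
noncomputable def stepProb {d : ℕ} (p : Dir d → ℝ) (Z : (latticeGraph d).Subgraph) (x : Site d)
    (e : Dir d) : ℝ :=
  if Z.Adj x (x + e.vec) then
    p e / ∑ e' : Dir d, (if Z.Adj x (x + e'.vec) then p e' else 0)
  else 0

/-- The σ-algebra generated by a random subgraph of `ℤ^d`. -/
abbrev graphSigma {d : ℕ} {Ω : Type*} (Z : Ω → (latticeGraph d).Subgraph) : MeasurableSpace Ω :=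
  MeasurableSpace.generateFrom
    ({A | ∃ x, A = {ω | x ∈ (Z ω).verts}} ∪ {A | ∃ x y, A = {ω | (Z ω).Adj x y}})

/-- The σ-algebra generated by the first steps `Y 0, …, Y n` of a process. -/
abbrev pastSigma {d : ℕ} {Ω : Type*} (Y : ℕ → Ω → Site d) (n : ℕ) : MeasurableSpace Ω :=
  ⨆ m : ℕ, ⨆ _ : m ≤ n, MeasurableSpace.comap (Y m) inferInstance

/-- The σ-algebra generated by all the walks with an index smaller than `i`. -/
abbrev earlierSigma {d : ℕ} {Ω : Type*} (X : ℕ∞ → ℕ → Ω → Site d) (i : ℕ) : MeasurableSpace Ω :=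
  ⨆ j : ℕ, ⨆ _ : j < i, ⨆ m : ℕ, MeasurableSpace.comap (X (j : ℕ∞) m) inferInstance

/-- Given the σ-algebra `𝒢`, with respect to which the graph `Z` is determined, the process `Y`
is a Markov chain started at the origin with the transition probabilities of the
`p`-random walk on `Z`. -/
structure IsRandomWalkOn {d : ℕ} {Ω : Type*} [MeasurableSpace Ω] (μ : MeasureTheory.Measure Ω)
    (p : Dir d → ℝ) (Z : Ω → (latticeGraph d).Subgraph) (𝒢 : MeasurableSpace Ω)
    (Y : ℕ → Ω → Site d) : Prop where
  start : ∀ᵐ ω ∂μ, Y 0 ω = 0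
  step : ∀ (n : ℕ) (e : Dir d),
    MeasureTheory.condExp (𝒢 ⊔ pastSigma Y n) μ
        (Set.indicator {ω | Y (n + 1) ω = Y n ω + e.vec} (fun _ => (1 : ℝ)))
      =ᵐ[μ] fun ω => stepProb p (Z ω) (Y n ω) e

/-- `X^(i)`, where `i` is a natural number or `∞`, is the sequence of random walks such that
`X^(i)` is a `p^(i)`-random walk on `Z^(i)`. For finite `i`, the walk is conditionally independent
of the earlier walks given `Z^(i)`; hence conditioning on all the earlier walks (which
determine `Z^(i)`) also gives a `p^(i)`-random walk on `Z^(i)`. -/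
structure IsWalkSequence {d : ℕ} {Ω : Type*} [MeasurableSpace Ω] (μ : MeasureTheory.Measure Ω)
    (p : ℕ∞ → Dir d → ℝ) (X : ℕ∞ → ℕ → Ω → Site d) : Prop where
  measurable : ∀ i n, Measurable (X i n)
  finite_walk : ∀ i : ℕ, IsRandomWalkOn μ (p i) (fun ω => walkGraph (fun j n => X j n ω) i)
    (earlierSigma X i) (X i)
  infinite_walk : IsRandomWalkOn μ (p ⊤) (fun ω => walkGraph (fun j n => X j n ω) ⊤)
    (graphSigma (fun ω => walkGraph (fun j n => X j n ω) ⊤)) (X ⊤)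

/-- The drift `δ` of a step distribution, `δ_j = p(e_j) - p(-e_j)`. -/
noncomputable def drift {d : ℕ} (p : Dir d → ℝ) : EuclideanSpace ℝ (Fin d) :=
  WithLp.toLp 2 fun j => p (j, 1) - p (j, -1)

/-- The vector with entries `log (p(e_j) / p(-e_j))`. -/
noncomputable def ellHat {d : ℕ} (p : Dir d → ℝ) : EuclideanSpace ℝ (Fin d) :=
  WithLp.toLp 2 fun j => Real.log (p (j, 1) / p (j, -1))

/-- The normalisation of `ellHat p` in the Euclidean norm (zero if `ellHat p` is zero). -/
noncomputable def ell {d : ℕ} (p : Dir d → ℝ) : EuclideanSpace ℝ (Fin d) :=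
  ‖ellHat p‖⁻¹ • ellHat p

/-- The walk `Y` on the random graph `Z` is recurrent: almost surely, it visits every vertex
of `Z`, and in particular the origin, infinitely often. -/
def IsRecurrentOn {d : ℕ} {Ω : Type*} [MeasurableSpace Ω] (μ : MeasureTheory.Measure Ω)
    (Z : Ω → (latticeGraph d).Subgraph) (Y : ℕ → Ω → Site d) : Prop :=
  ∀ᵐ ω ∂μ, (0 : Site d) ∈ (Z ω).verts ∧ ∀ x ∈ (Z ω).verts, ∃ᶠ n in Filter.atTop, Y n ω = x

/-! A `p`-walk on a subgraph of the lattice is reversible: the edge from `x` to `x + e` has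
conductance `p e * exp (ellHat p · x)`. All graphs Z^(i) with i ≥ 1 lie inside the trace of X^(0), a
lattice walk with positive drift in the first coordinate. If at time `n` this coordinate is at its
maximum so far and is exceeded at every later time, then the edge traversed at time `n` is the only
link between the finite past of the trace and its future (`isCut_traceGraph`). When infinitely many
such cut edges have bounded conductance, every walk on a connected subgraph returns, as in the
Nash-Williams criterion: an escaping walk would send the same positive flux through each cut edge,
at infinite energy cost (`stepOp_everHitProb_eq_one`, `tendsto_hitProb_one`).

The conductance of a cut edge for the i-th walk is at most exp(ellHat^(i) · X^(0)_n), so it suffices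
that this functional is bounded above along infinitely many cut times
(`ae_exists_frequently_isCutTime`). It performs a random walk whose mean step is nonpositive, by
δ^(0) · ℓ^(i) ≤ 0. By the central limit theorem it is nonpositive with probability bounded below at
infinitely many times; forcing a fixed number of steps e_1 after such a time creates a cut time,
with probability still bounded below. Kolmogorov's zero-one law turns positive probability into
probability one.

Connectedness of Z^(∞) also comes from the cuts, since inside a finite piece the decreasing graphs
stabilise (`iInf_connected`). Finally, hitting probabilities equal to one on the fixed graph are
transferred to the process by the Markov property (`IsRandomWalkOn.isRecurrentOn`). -/

/-! ### Reversible networks: conductances, truncated hitting probabilities, summation by parts. -/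

section Network

open Filter Topology

variable {d : ℕ}

/-- The transition operator of the `p`-random walk on `Z`. -/
noncomputable def stepOp (p : Dir d → ℝ) (Z : (latticeGraph d).Subgraph) (f : Site d → ℝ)
    (x : Site d) : ℝ :=
  ∑ e : Dir d, stepProb p Z x e * f (x + e.vec)

open Classical in
/-- The probability that the `p`-random walk on `Z` started at `x` visits `z` within `n` steps. -/
noncomputable def hitProb (p : Dir d → ℝ) (Z : (latticeGraph d).Subgraph) (z : Site d) :
    ℕ → Site d → ℝ
  | 0, x => if x = z then 1 else 0
  | n + 1, x => if x = z then 1 else stepOp p Z (hitProb p Z z n) x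

/-- The linear functional `x ↦ w · x` on lattice points. -/
noncomputable def siteDot (w : Fin d → ℝ) (x : Site d) : ℝ := ∑ j, w j * (x j : ℝ)

open Classical in
/-- The weight of the step `e` from `x`, with respect to which the `p`-random walk on `Z`
is reversible. -/
noncomputable def stepWeight (p : Dir d → ℝ) (Z : (latticeGraph d).Subgraph) (x : Site d)
    (e : Dir d) : ℝ :=
  if Z.Adj x (x + e.vec) then p e * Real.exp (siteDot (ellHat p) x) else 0

open Classical in
/-- The conductance of the pair `x`, `y` of sites. -/
noncomputable def conductance (p : Dir d → ℝ) (Z : (latticeGraph d).Subgraph) (x y : Site d) : ℝ :=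
  ∑ e : Dir d, if y = x + e.vec then stepWeight p Z x e else 0

/-- The reversible measure of the `p`-random walk on `Z`. -/
noncomputable def vertexWeight (p : Dir d → ℝ) (Z : (latticeGraph d).Subgraph) (x : Site d) : ℝ :=
  ∑ e : Dir d, stepWeight p Z x e

/-- The reversed unit step. -/
def Dir.opp (e : Dir d) : Dir d := (e.1, -e.2)

theorem Dir.opp_opp (e : Dir d) : e.opp.opp = e := by simp [Dir.opp]

theorem Dir.vec_opp (e : Dir d) : e.opp.vec = -e.vec := by
  simp [Dir.opp, Dir.vec, Pi.single_neg]

theorem siteDot_add (w : Fin d → ℝ) (x y : Site d) :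
    siteDot w (x + y) = siteDot w x + siteDot w y := by
  simp [siteDot, mul_add, Finset.sum_add_distrib]

theorem siteDot_vec (w : Fin d → ℝ) (e : Dir d) : siteDot w e.vec = w e.1 * ((e.2 : ℤ) : ℝ) := by
  rw [siteDot, Finset.sum_eq_single e.1]
  · simp [Dir.vec]
  · intro j _ hj
    simp [Dir.vec, Pi.single_eq_of_ne hj]
  · simp

/-- Detailed balance: a step `e` multiplies the exponential weight by `p e / p e.opp`, which is how
`ellHat` is defined. -/
theorem weight_opp {p : Dir d → ℝ} (hp : ∀ e, 0 < p e) (x : Site d) (e : Dir d) :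
    p e.opp * Real.exp (siteDot (ellHat p) (x + e.vec)) =
      p e * Real.exp (siteDot (ellHat p) x) := by
  obtain ⟨j, s⟩ := e
  rw [siteDot_add, siteDot_vec, Real.exp_add]
  have h1 := hp (j, 1)
  have h2 := hp (j, -1)
  rcases Int.units_eq_one_or s with rfl | rfl
  · simp only [Dir.opp, ellHat, Units.val_one, Int.cast_one, mul_one]
    rw [Real.exp_log (by positivity)]
    field_simp
  · simp only [Dir.opp, ellHat, Units.val_neg, Units.val_one, Int.cast_neg, Int.cast_one, mul_neg,
      mul_one, Real.exp_neg, neg_neg]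
    rw [Real.exp_log (by positivity)]
    field_simp

theorem stepWeight_nonneg {p : Dir d → ℝ} (hp : ∀ e, 0 < p e) (Z : (latticeGraph d).Subgraph)
    (x : Site d) (e : Dir d) : 0 ≤ stepWeight p Z x e := by
  unfold stepWeight
  split_ifs
  · exact mul_nonneg (hp e).le (Real.exp_pos _).le
  · exact le_rfl

theorem vertexWeight_nonneg {p : Dir d → ℝ} (hp : ∀ e, 0 < p e) (Z : (latticeGraph d).Subgraph)
    (x : Site d) : 0 ≤ vertexWeight p Z x :=
  Finset.sum_nonneg fun e _ => stepWeight_nonneg hp Z x e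

theorem conductance_nonneg {p : Dir d → ℝ} (hp : ∀ e, 0 < p e) (Z : (latticeGraph d).Subgraph)
    (x y : Site d) : 0 ≤ conductance p Z x y :=
  Finset.sum_nonneg fun e _ => by
    split_ifs
    · exact stepWeight_nonneg hp Z x e
    · exact le_rfl

theorem conductance_comm {p : Dir d → ℝ} (hp : ∀ e, 0 < p e) (Z : (latticeGraph d).Subgraph)
    (x y : Site d) : conductance p Z x y = conductance p Z y x := by
  unfold conductance
  refine Finset.sum_bij' (fun e _ => e.opp) (fun e _ => e.opp) (by simp) (by simp)
    (fun e _ => e.opp_opp) (fun e _ => e.opp_opp) fun e _ => ?_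
  by_cases h : y = x + e.vec
  · subst h
    have h' : x = x + e.vec + e.opp.vec := by rw [Dir.vec_opp]; abel
    rw [if_pos rfl, if_pos h']
    unfold stepWeight
    rw [← h', Z.adj_comm, weight_opp hp]
  · have h' : ¬ x = y + e.opp.vec := by
      rw [Dir.vec_opp]
      rintro rfl
      exact h (by abel)
    rw [if_neg h, if_neg h']

theorem conductance_eq_zero {p : Dir d → ℝ} {Z : (latticeGraph d).Subgraph} {x y : Site d}
    (h : ¬ Z.Adj x y) : conductance p Z x y = 0 := by
  refine Finset.sum_eq_zero fun e _ => ?_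
  split_ifs with hy
  · subst hy
    simp [stepWeight, h]
  · rfl

/-- This is what converts an upper bound on the linear functional at a cut time into a bound on the
conductance of the cut edge. -/
theorem conductance_le {p : Dir d → ℝ} (hp : ∀ e, 0 < p e) (hp1 : ∑ e, p e = 1)
    (Z : (latticeGraph d).Subgraph) (x y : Site d) :
    conductance p Z x y ≤ Real.exp (siteDot (ellHat p) x) := by
  rw [← one_mul (Real.exp _), ← hp1, Finset.sum_mul]
  refine Finset.sum_le_sum fun e _ => ?_
  have := mul_nonneg (hp e).le (Real.exp_pos (siteDot (ellHat p) x)).le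
  unfold stepWeight
  split_ifs <;> first | exact le_rfl | exact this

theorem vertexWeight_mul_stepProb {p : Dir d → ℝ} (hp : ∀ e, 0 < p e)
    (Z : (latticeGraph d).Subgraph) (x : Site d) (e : Dir d) :
    vertexWeight p Z x * stepProb p Z x e = stepWeight p Z x e := by
  classical
  have hv : vertexWeight p Z x = (∑ e' : Dir d, (if Z.Adj x (x + e'.vec) then p e' else 0)) *
      Real.exp (siteDot (ellHat p) x) := by
    rw [vertexWeight, Finset.sum_mul]
    refine Finset.sum_congr rfl fun e' _ => ?_
    rw [stepWeight, ite_mul, zero_mul]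
  rw [hv]
  unfold stepProb stepWeight
  split_ifs with h
  · have hpos : 0 < ∑ e' : Dir d, (if Z.Adj x (x + e'.vec) then p e' else 0) := by
      refine Finset.sum_pos' (fun e' _ => ?_) ⟨e, Finset.mem_univ _, by simpa [h] using hp e⟩
      split_ifs
      · exact (hp e').le
      · exact le_rfl
    convert_to (∑ e' : Dir d, (if Z.Adj x (x + e'.vec) then p e' else 0)) *
      Real.exp (siteDot (ellHat p) x) * (p e / ∑ e' : Dir d, (if Z.Adj x (x + e'.vec) then p e' else 0)) = _
    field_simp
  · simp

theorem stepProb_nonneg {p : Dir d → ℝ} (hp : ∀ e, 0 < p e) (Z : (latticeGraph d).Subgraph)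
    (x : Site d) (e : Dir d) : 0 ≤ stepProb p Z x e := by
  classical
  unfold stepProb
  split_ifs
  · refine div_nonneg (hp e).le (Finset.sum_nonneg fun e' _ => ?_)
    split_ifs
    · exact (hp e').le
    · exact le_rfl
  · exact le_rfl

theorem stepProb_pos_iff {p : Dir d → ℝ} (hp : ∀ e, 0 < p e) (Z : (latticeGraph d).Subgraph)
    (x : Site d) (e : Dir d) : 0 < stepProb p Z x e ↔ Z.Adj x (x + e.vec) := by
  classical
  unfold stepProb
  split_ifs with h
  · simp only [h, iff_true]
    refine div_pos (hp e) (Finset.sum_pos' (fun e' _ => ?_)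
      ⟨e, Finset.mem_univ _, by simpa [h] using hp e⟩)
    split_ifs
    · exact (hp e').le
    · exact le_rfl
  · simp [h]

theorem sum_stepProb {p : Dir d → ℝ} (hp : ∀ e, 0 < p e) (Z : (latticeGraph d).Subgraph)
    (x : Site d) {e₀ : Dir d} (h : Z.Adj x (x + e₀.vec)) : ∑ e, stepProb p Z x e = 1 := by
  have h0 : 0 < vertexWeight p Z x := by
    refine Finset.sum_pos' (fun e _ => stepWeight_nonneg hp Z x e) ⟨e₀, Finset.mem_univ _, ?_⟩
    rw [stepWeight, if_pos h]
    exact mul_pos (hp e₀) (Real.exp_pos _)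
  have := Finset.sum_congr rfl fun e (_ : e ∈ Finset.univ) => vertexWeight_mul_stepProb hp Z x e
  rw [← Finset.mul_sum] at this
  exact mul_left_cancel₀ h0.ne' (this.trans (mul_one _).symm)

/-- At a site without neighbours in `Z` the sum is zero, so equality can fail. -/
theorem sum_stepProb_le_one {p : Dir d → ℝ} (hp : ∀ e, 0 < p e) (Z : (latticeGraph d).Subgraph)
    (x : Site d) : ∑ e, stepProb p Z x e ≤ 1 := by
  by_cases h : ∃ e₀ : Dir d, Z.Adj x (x + e₀.vec)
  · exact (sum_stepProb hp Z x h.choose_spec).le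
  · push Not at h
    simp [stepProb, h]

theorem stepOp_mono {p : Dir d → ℝ} (hp : ∀ e, 0 < p e) (Z : (latticeGraph d).Subgraph)
    {f g : Site d → ℝ} (h : ∀ x, f x ≤ g x) (x : Site d) : stepOp p Z f x ≤ stepOp p Z g x :=
  Finset.sum_le_sum fun _ _ => mul_le_mul_of_nonneg_left (h _) (stepProb_nonneg hp Z x _)

theorem stepOp_nonneg {p : Dir d → ℝ} (hp : ∀ e, 0 < p e) (Z : (latticeGraph d).Subgraph)
    {f : Site d → ℝ} (h : ∀ x, 0 ≤ f x) (x : Site d) : 0 ≤ stepOp p Z f x :=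
  Finset.sum_nonneg fun _ _ => mul_nonneg (stepProb_nonneg hp Z x _) (h _)

theorem stepOp_le_one {p : Dir d → ℝ} (hp : ∀ e, 0 < p e) (Z : (latticeGraph d).Subgraph)
    {f : Site d → ℝ} (h : ∀ x, f x ≤ 1) (x : Site d) : stepOp p Z f x ≤ 1 :=
  (stepOp_mono hp Z h x).trans (by simpa [stepOp] using sum_stepProb_le_one hp Z x)

theorem hitProb_self (p : Dir d → ℝ) (Z : (latticeGraph d).Subgraph) (z : Site d) (n : ℕ) :
    hitProb p Z z n z = 1 := by
  cases n <;> simp [hitProb]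

theorem hitProb_succ_of_ne (p : Dir d → ℝ) (Z : (latticeGraph d).Subgraph) {z x : Site d}
    (h : x ≠ z) (n : ℕ) : hitProb p Z z (n + 1) x = stepOp p Z (hitProb p Z z n) x := by
  simp [hitProb, h]

theorem hitProb_nonneg {p : Dir d → ℝ} (hp : ∀ e, 0 < p e) (Z : (latticeGraph d).Subgraph)
    (z : Site d) (n : ℕ) (x : Site d) : 0 ≤ hitProb p Z z n x := by
  induction n generalizing x with
  | zero => unfold hitProb; split_ifs <;> norm_num
  | succ n ih =>
    unfold hitProb
    split_ifs
    · norm_num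
    · exact stepOp_nonneg hp Z ih x

theorem hitProb_le_one {p : Dir d → ℝ} (hp : ∀ e, 0 < p e) (Z : (latticeGraph d).Subgraph)
    (z : Site d) (n : ℕ) (x : Site d) : hitProb p Z z n x ≤ 1 := by
  induction n generalizing x with
  | zero => unfold hitProb; split_ifs <;> norm_num
  | succ n ih =>
    unfold hitProb
    split_ifs
    · norm_num
    · exact stepOp_le_one hp Z ih x

theorem hitProb_le_succ {p : Dir d → ℝ} (hp : ∀ e, 0 < p e) (Z : (latticeGraph d).Subgraph)
    (z : Site d) (n : ℕ) (x : Site d) : hitProb p Z z n x ≤ hitProb p Z z (n + 1) x := by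
  induction n generalizing x with
  | zero =>
    by_cases h : x = z
    · subst h; simp [hitProb_self]
    · rw [hitProb, if_neg h]
      exact hitProb_nonneg hp Z z _ x
  | succ n ih =>
    by_cases h : x = z
    · subst h; simp [hitProb_self]
    · rw [hitProb_succ_of_ne p Z h, hitProb_succ_of_ne p Z h]
      exact stepOp_mono hp Z ih x

theorem monotone_hitProb {p : Dir d → ℝ} (hp : ∀ e, 0 < p e) (Z : (latticeGraph d).Subgraph)
    (z x : Site d) : Monotone fun n => hitProb p Z z n x :=
  monotone_nat_of_le_succ fun n => hitProb_le_succ hp Z z n x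

/-- The reason for truncating at `n` steps: summation by parts then involves finite sums only. -/
theorem finite_support_hitProb (p : Dir d → ℝ) (Z : (latticeGraph d).Subgraph)
    (z : Site d) (n : ℕ) : (Function.support (hitProb p Z z n)).Finite := by
  induction n with
  | zero =>
    refine (Set.finite_singleton z).subset fun x hx => ?_
    by_contra h
    exact hx (by simp_all [hitProb])
  | succ n ih =>
    refine ((Set.finite_singleton z).union
      (Set.finite_iUnion fun e : Dir d => ih.image fun y => y - e.vec)).subset fun x hx => ?_
    by_cases h : x = z
    · exact Or.inl h
    · refine Or.inr ?_
      rw [Function.mem_support, hitProb_succ_of_ne p Z h, stepOp] at hx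
      obtain ⟨e, -, he⟩ := Finset.exists_ne_zero_of_sum_ne_zero hx
      exact Set.mem_iUnion.2 ⟨e, x + e.vec, right_ne_zero_of_mul he, by simp⟩

theorem vertexWeight_mul_sub_stepOp {p : Dir d → ℝ} (hp : ∀ e, 0 < p e)
    (Z : (latticeGraph d).Subgraph) (f : Site d → ℝ) {x : Site d} {B : Finset (Site d)}
    (hB : ∀ e : Dir d, x + e.vec ∈ B) :
    vertexWeight p Z x * (f x - stepOp p Z f x) = ∑ y ∈ B, conductance p Z x y * (f x - f y) := by
  classical
  have h1 : ∑ y ∈ B, conductance p Z x y * (f x - f y) =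
      ∑ e : Dir d, stepWeight p Z x e * (f x - f (x + e.vec)) := by
    simp only [conductance, Finset.sum_mul]
    rw [Finset.sum_comm]
    refine Finset.sum_congr rfl fun e _ => ?_
    simp only [ite_mul, zero_mul]
    rw [Finset.sum_ite_eq' B, if_pos (hB e)]
  rw [h1, mul_sub, vertexWeight, Finset.sum_mul, stepOp, Finset.mul_sum, ← Finset.sum_sub_distrib]
  refine Finset.sum_congr rfl fun e _ => ?_
  rw [← vertexWeight, ← mul_assoc, vertexWeight_mul_stepProb hp]
  ring

/-- Discrete Green formula. The sum on the right runs over ordered pairs, hence the division by two.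
-/
theorem sum_mul_symm_sub {V : Type*} (B : Finset V) {c : V → V → ℝ} (hc : ∀ x y, c x y = c y x)
    (f : V → ℝ) :
    ∑ x ∈ B, f x * ∑ y ∈ B, c x y * (f x - f y) =
      (∑ q ∈ B ×ˢ B, c q.1 q.2 * (f q.1 - f q.2) ^ 2) / 2 := by
  have h : ∑ x ∈ B, f x * ∑ y ∈ B, c x y * (f x - f y) =
      ∑ x ∈ B, ∑ y ∈ B, c x y * (f y * (f y - f x)) := by
    rw [Finset.sum_comm]
    refine Finset.sum_congr rfl fun x _ => ?_
    rw [Finset.mul_sum]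
    refine Finset.sum_congr rfl fun y _ => ?_
    rw [hc]
    ring
  rw [eq_div_iff two_ne_zero, mul_two]
  nth_rw 2 [h]
  rw [Finset.sum_product, ← Finset.sum_add_distrib]
  refine Finset.sum_congr rfl fun x _ => ?_
  rw [Finset.mul_sum, ← Finset.sum_add_distrib]
  refine Finset.sum_congr rfl fun y _ => ?_
  dsimp only
  ring

/-- Discrete divergence theorem: flows between two points of `A` cancel by antisymmetry. -/
theorem sum_symm_sub {V : Type*} [DecidableEq V] {A B : Finset V} (hAB : A ⊆ B) {c : V → V → ℝ}
    (hc : ∀ x y, c x y = c y x) (f : V → ℝ) :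
    ∑ x ∈ A, ∑ y ∈ B, c x y * (f x - f y) = ∑ x ∈ A, ∑ y ∈ B \ A, c x y * (f x - f y) := by
  have h : ∑ x ∈ A, ∑ y ∈ A, c x y * (f x - f y) = 0 := by
    have h' : ∑ x ∈ A, ∑ y ∈ A, c x y * (f x - f y) = -∑ x ∈ A, ∑ y ∈ A, c x y * (f x - f y) := by
      nth_rw 1 [Finset.sum_comm]
      rw [← Finset.sum_neg_distrib]
      refine Finset.sum_congr rfl fun x _ => ?_
      rw [← Finset.sum_neg_distrib]
      refine Finset.sum_congr rfl fun y _ => ?_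
      rw [hc]
      ring
    linarith
  rw [← add_zero (∑ x ∈ A, ∑ y ∈ B \ A, _), ← h, ← Finset.sum_add_distrib]
  exact Finset.sum_congr rfl fun x _ => (Finset.sum_sdiff hAB).symm

end Network
-- Recurrence of networks with infinitely many cut edges of bounded conductance.
section Recurrence

open Filter Topology

variable {d : ℕ}

/-- The pair `(a, b)` is the only edge of `Z` which leaves the finite set `A`. -/
structure IsCut (Z : (latticeGraph d).Subgraph) (A : Finset (Site d)) (a b : Site d) : Prop where
  left_mem : a ∈ A
  right_notMem : b ∉ A
  eq_of_adj : ∀ x ∈ A, ∀ y, y ∉ A → Z.Adj x y → x = a ∧ y = b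

theorem exists_neighbour_closed (A : Finset (Site d)) :
    ∃ B : Finset (Site d), A ⊆ B ∧ ∀ x ∈ A, ∀ e : Dir d, x + e.vec ∈ B := by
  classical
  refine ⟨A ∪ (A ×ˢ Finset.univ).image fun q : Site d × Dir d => q.1 + q.2.vec,
    Finset.subset_union_left, fun x hx e => Finset.mem_union_right _ ?_⟩
  exact Finset.mem_image.2 ⟨(x, e), by simpa using hx, rfl⟩

theorem IsCut.flux {p : Dir d → ℝ} (hp : ∀ e, 0 < p e) {Z : (latticeGraph d).Subgraph}
    {A : Finset (Site d)} {a b : Site d} (h : IsCut Z A a b) (f : Site d → ℝ) :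
    ∑ x ∈ A, vertexWeight p Z x * (f x - stepOp p Z f x) =
      conductance p Z a b * (f a - f b) := by
  classical
  obtain ⟨B₀, hAB₀, hB₀⟩ := exists_neighbour_closed A
  set B := insert b B₀
  have hAB : A ⊆ B := hAB₀.trans (Finset.subset_insert _ _)
  rw [Finset.sum_congr rfl fun x hx => vertexWeight_mul_sub_stepOp hp Z f (B := B)
    fun e => Finset.mem_insert_of_mem (hB₀ x hx e), sum_symm_sub hAB (conductance_comm hp Z)]
  have hz : ∀ x ∈ A, ∀ y ∈ B \ A, ¬ (x = a ∧ y = b) →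
      conductance p Z x y * (f x - f y) = 0 := by
    intro x hx y hy hne
    rw [conductance_eq_zero fun hadj => hne (h.eq_of_adj x hx y (Finset.mem_sdiff.1 hy).2 hadj),
      zero_mul]
  rw [Finset.sum_eq_single a, Finset.sum_eq_single b]
  · exact fun y hy hne => hz a h.left_mem y hy fun h' => hne h'.2
  · exact fun hb => absurd (Finset.mem_sdiff.2 ⟨Finset.mem_insert_self _ _, h.right_notMem⟩) hb
  · exact fun x hx hne => Finset.sum_eq_zero fun y hy => hz x hx y hy fun h' => hne h'.1
  · exact fun ha => absurd h.left_mem ha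

/-- By monotonicity in `n`, the truncated hitting probability is subharmonic away from `z`. So only
`z` contributes positively to the Green formula. -/
theorem energy_hitProb_le {p : Dir d → ℝ} (hp : ∀ e, 0 < p e) (Z : (latticeGraph d).Subgraph)
    (z : Site d) (n : ℕ) (I : Finset (Site d × Site d)) :
    ∑ q ∈ I, conductance p Z q.1 q.2 * (hitProb p Z z n q.1 - hitProb p Z z n q.2) ^ 2 ≤
      2 * (vertexWeight p Z z * (1 - stepOp p Z (hitProb p Z z n) z)) := by
  classical
  set f := hitProb p Z z n with hf
  set S := (finite_support_hitProb p Z z n).toFinset with hS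
  obtain ⟨B₀, hSB₀, hB₀⟩ := exists_neighbour_closed S
  set B := B₀ ∪ I.image Prod.fst ∪ I.image Prod.snd with hBdef
  have hB₀B : B₀ ⊆ B := fun x hx =>
    Finset.mem_union_left _ (Finset.mem_union_left _ hx)
  have hIB : I ⊆ B ×ˢ B := fun q hq => Finset.mem_product.2
    ⟨Finset.mem_union_left _ (Finset.mem_union_right _ (Finset.mem_image_of_mem _ hq)),
      Finset.mem_union_right _ (Finset.mem_image_of_mem _ hq)⟩
  have hz : z ∈ S := by simp [hS, hitProb_self]
  have h1 : ∑ q ∈ I, conductance p Z q.1 q.2 * (f q.1 - f q.2) ^ 2 ≤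
      ∑ q ∈ B ×ˢ B, conductance p Z q.1 q.2 * (f q.1 - f q.2) ^ 2 :=
    Finset.sum_le_sum_of_subset_of_nonneg hIB fun q _ _ =>
      mul_nonneg (conductance_nonneg hp Z _ _) (sq_nonneg _)
  have h2 := sum_mul_symm_sub B (conductance_comm hp Z) f
  have h3 : ∑ x ∈ B, f x * ∑ y ∈ B, conductance p Z x y * (f x - f y) ≤
      ∑ x ∈ B, if x = z then vertexWeight p Z z * (1 - stepOp p Z f z) else 0 := by
    refine Finset.sum_le_sum fun x _ => ?_
    by_cases hx : x ∈ S
    · rw [← vertexWeight_mul_sub_stepOp hp Z f fun e => hB₀B (hB₀ x hx e)]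
      split_ifs with hxz
      · subst hxz
        rw [hf, hitProb_self, one_mul]
      · have := hitProb_le_succ hp Z z n x
        rw [hitProb_succ_of_ne p Z hxz] at this
        exact mul_nonpos_of_nonneg_of_nonpos (hitProb_nonneg hp Z z n x)
          (mul_nonpos_of_nonneg_of_nonpos (vertexWeight_nonneg hp Z x) (sub_nonpos.2 this))
    · have h0 : f x = 0 := by simpa [hS] using hx
      have hxz : x ≠ z := by
        rintro rfl
        exact hx hz
      rw [if_neg hxz, h0, zero_mul]
  rw [Finset.sum_ite_eq' B, if_pos (hB₀B (hSB₀ hz))] at h3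
  linarith

/-- The probability that the `p`-random walk on `Z` started at `x` ever visits `z`. -/
noncomputable def everHitProb (p : Dir d → ℝ) (Z : (latticeGraph d).Subgraph) (z x : Site d) : ℝ :=
  ⨆ n, hitProb p Z z n x

theorem tendsto_hitProb {p : Dir d → ℝ} (hp : ∀ e, 0 < p e) (Z : (latticeGraph d).Subgraph)
    (z x : Site d) : Tendsto (fun n => hitProb p Z z n x) atTop (𝓝 (everHitProb p Z z x)) :=
  tendsto_atTop_ciSup (monotone_hitProb hp Z z x)
    ⟨1, by rintro _ ⟨n, rfl⟩; exact hitProb_le_one hp Z z n x⟩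

theorem tendsto_stepOp {p : Dir d → ℝ} {Z : (latticeGraph d).Subgraph} {f : ℕ → Site d → ℝ}
    {g : Site d → ℝ} (h : ∀ x, Tendsto (fun n => f n x) atTop (𝓝 (g x))) (x : Site d) :
    Tendsto (fun n => stepOp p Z (f n) x) atTop (𝓝 (stepOp p Z g x)) :=
  tendsto_finsetSum _ fun _ _ => (h _).const_mul _

theorem everHitProb_self (p : Dir d → ℝ) (Z : (latticeGraph d).Subgraph) (z : Site d) :
    everHitProb p Z z z = 1 := by
  simp [everHitProb, hitProb_self]

theorem everHitProb_le_one {p : Dir d → ℝ} (hp : ∀ e, 0 < p e) (Z : (latticeGraph d).Subgraph)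
    (z x : Site d) : everHitProb p Z z x ≤ 1 :=
  ciSup_le fun n => hitProb_le_one hp Z z n x

theorem everHitProb_of_ne {p : Dir d → ℝ} (hp : ∀ e, 0 < p e) (Z : (latticeGraph d).Subgraph)
    {z x : Site d} (h : x ≠ z) : everHitProb p Z z x = stepOp p Z (everHitProb p Z z) x := by
  refine tendsto_nhds_unique ((tendsto_add_atTop_iff_nat 1).2 (tendsto_hitProb hp Z z x)) ?_
  simp only [hitProb_succ_of_ne p Z h]
  exact tendsto_stepOp (tendsto_hitProb hp Z z) x

/-- If infinitely many single edges of bounded conductance separate `z` from infinity, then the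
walk returns to `z`. -/
theorem stepOp_everHitProb_eq_one {p : Dir d → ℝ} (hp : ∀ e, 0 < p e)
    {Z : (latticeGraph d).Subgraph} {z : Site d} (hz : 0 < vertexWeight p Z z) {T : Set ℕ}
    (hT : T.Infinite) {A : ℕ → Finset (Site d)} {a b : ℕ → Site d}
    (hcut : ∀ n ∈ T, IsCut Z (A n) (a n) (b n)) (ha : Set.InjOn a T) (hzA : ∀ n ∈ T, z ∈ A n)
    {M : ℝ} (hM : ∀ n ∈ T, conductance p Z (a n) (b n) ≤ M) :
    stepOp p Z (everHitProb p Z z) z = 1 := by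
  classical
  -- The probability of never returning to `z`.
  set ε := 1 - stepOp p Z (everHitProb p Z z) z with hε
  have hε0 : 0 ≤ ε := sub_nonneg.2 (stepOp_le_one hp Z (everHitProb_le_one hp Z z) z)
  -- In the limit the function is harmonic off `z`, so every cut edge carries the whole flux that
  -- leaves `z`.
  have hflux : ∀ n ∈ T, Tendsto (fun N => conductance p Z (a n) (b n) *
      (hitProb p Z z N (a n) - hitProb p Z z N (b n))) atTop (𝓝 (vertexWeight p Z z * ε)) := by
    intro n hn
    simp only [← (hcut n hn).flux hp]
    have h1 : vertexWeight p Z z * ε = ∑ x ∈ A n, vertexWeight p Z x *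
        (everHitProb p Z z x - stepOp p Z (everHitProb p Z z) x) := by
      rw [Finset.sum_eq_single z]
      · rw [everHitProb_self]
      · intro x _ hx
        rw [← everHitProb_of_ne hp Z hx, sub_self, mul_zero]
      · exact fun h => absurd (hzA n hn) h
    rw [h1]
    exact tendsto_finsetSum _ fun x _ => ((tendsto_hitProb hp Z z x).sub
      (tendsto_stepOp (tendsto_hitProb hp Z z) x)).const_mul _
  -- The squared flux through a cut edge is at most `M` times its energy, and the total energy is
  -- bounded. With arbitrarily many cuts this forces the flux to vanish.
  have key : ∀ I : Finset ℕ, (I : Set ℕ) ⊆ T →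
      I.card * (vertexWeight p Z z * ε) ^ 2 ≤ M * (2 * (vertexWeight p Z z * ε)) := by
    intro I hI
    have hsum : ∀ N, ∑ n ∈ I, (conductance p Z (a n) (b n) *
        (hitProb p Z z N (a n) - hitProb p Z z N (b n))) ^ 2 ≤
        M * (2 * (vertexWeight p Z z * (1 - stepOp p Z (hitProb p Z z N) z))) := by
      intro N
      have hinj : Set.InjOn (fun n => (a n, b n)) (I : Set ℕ) := fun m hm n hn h =>
        ha (hI hm) (hI hn) (Prod.ext_iff.1 h).1
      have h1 := energy_hitProb_le hp Z z N (I.image fun n => (a n, b n))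
      rw [Finset.sum_image hinj] at h1
      rcases I.eq_empty_or_nonempty with rfl | ⟨n₀, hn₀⟩
      · simp only [Finset.sum_empty]
        obtain ⟨n₀, hn₀⟩ := hT.nonempty
        have hM0 := (conductance_nonneg hp Z _ _).trans (hM n₀ hn₀)
        have := stepOp_le_one hp Z (hitProb_le_one hp Z z N) z
        exact mul_nonneg hM0 (mul_nonneg zero_le_two (mul_nonneg hz.le (by linarith)))
      have hM0 := (conductance_nonneg hp Z _ _).trans (hM n₀ (hI hn₀))
      refine le_trans ?_ (mul_le_mul_of_nonneg_left h1 hM0)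
      rw [Finset.mul_sum]
      refine Finset.sum_le_sum fun n hn => ?_
      rw [mul_pow, sq (conductance p Z (a n) (b n)), mul_assoc]
      exact mul_le_mul_of_nonneg_right (hM n (hI hn))
        (mul_nonneg (conductance_nonneg hp Z _ _) (sq_nonneg _))
    have hl := le_of_tendsto_of_tendsto' (tendsto_finsetSum I fun n hn => (hflux n (hI hn)).pow 2)
      ((((tendsto_stepOp (tendsto_hitProb hp Z z) z).const_sub 1).const_mul _ |>.const_mul 2
        |>.const_mul M)) hsum
    simpa using hl
  by_contra hne
  have hpos : 0 < vertexWeight p Z z * ε :=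
    mul_pos hz (lt_of_le_of_ne hε0 fun h => hne (by linarith))
  obtain ⟨k, hk⟩ := exists_nat_gt (2 * M / (vertexWeight p Z z * ε))
  obtain ⟨I, hI, hcard⟩ := hT.exists_subset_card_eq k
  have := key I hI
  rw [hcard] at this
  rw [div_lt_iff₀ hpos] at hk
  nlinarith

/-- Maximum principle: an average of values at most one equals one only if every value with positive
weight does. -/
theorem eq_one_of_stepOp_eq_one {p : Dir d → ℝ} (hp : ∀ e, 0 < p e)
    {Z : (latticeGraph d).Subgraph} {f : Site d → ℝ} (hf : ∀ x, f x ≤ 1) {x y : Site d}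
    (h : stepOp p Z f x = 1) {e : Dir d} (hy : y = x + e.vec) (hxy : Z.Adj x y) : f y = 1 := by
  subst hy
  refine le_antisymm (hf _) (not_lt.1 fun hlt => ?_)
  have : stepOp p Z f x < ∑ e, stepProb p Z x e :=
    Finset.sum_lt_sum (fun e _ => mul_le_of_le_one_right (stepProb_nonneg hp Z x e) (hf _))
      ⟨e, Finset.mem_univ _, mul_lt_of_lt_one_right ((stepProb_pos_iff hp Z x e).2 hxy) hlt⟩
  linarith [sum_stepProb_le_one hp Z x]

theorem exists_dir_of_adj {x y : Site d} (h : (latticeGraph d).Adj x y) :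
    ∃ e : Dir d, y = x + e.vec := by
  have h : ∑ j, |x j - y j| = 1 := h
  obtain ⟨j, hj⟩ : ∃ j, x j - y j ≠ 0 := by
    by_contra! h'
    simp [h'] at h
  have hsplit := Finset.add_sum_erase Finset.univ (fun k => |x k - y k|) (Finset.mem_univ j)
  have hnn : 0 ≤ ∑ k ∈ Finset.univ.erase j, |x k - y k| :=
    Finset.sum_nonneg fun k _ => abs_nonneg _
  have h1 : 1 ≤ |x j - y j| := Int.one_le_abs hj
  have h0 : ∑ k ∈ Finset.univ.erase j, |x k - y k| = 0 := by
    linarith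
  have h1' : |x j - y j| = 1 := by linarith
  have hk : ∀ k, k ≠ j → y k = x k := by
    intro k hkj
    have := (Finset.sum_eq_zero_iff_of_nonneg fun k _ => abs_nonneg (x k - y k)).1 h0 k
      (by simp [hkj])
    rw [abs_eq_zero] at this
    linarith
  rcases (abs_eq zero_le_one).1 h1' with h' | h'
  · refine ⟨(j, -1), funext fun k => ?_⟩
    rcases eq_or_ne k j with rfl | hkj
    · simp [Dir.vec]; linarith
    · simp [Dir.vec, Pi.single_eq_of_ne hkj, hk k hkj]
  · refine ⟨(j, 1), funext fun k => ?_⟩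
    rcases eq_or_ne k j with rfl | hkj
    · simp [Dir.vec]; linarith
    · simp [Dir.vec, Pi.single_eq_of_ne hkj, hk k hkj]

theorem latticeGraph_adj_add_vec (x : Site d) (e : Dir d) :
    (latticeGraph d).Adj x (x + e.vec) := by
  change ∑ j, |x j - (x + e.vec) j| = 1
  rw [Finset.sum_eq_single e.1]
  · rcases Int.units_eq_one_or e.2 with h | h <;> simp [Dir.vec, h]
  · intro j _ hj
    simp [Dir.vec, Pi.single_eq_of_ne hj]
  · simp

theorem Dir.vec_injective : Function.Injective (Dir.vec : Dir d → Site d) := by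
  rintro ⟨j, s⟩ ⟨k, t⟩ h
  have hj := congrFun h j
  simp only [Dir.vec, Pi.single_eq_same] at hj
  have hjk : j = k := by
    by_contra hne
    rw [Pi.single_eq_of_ne hne] at hj
    exact s.ne_zero hj
  subst hjk
  rw [Pi.single_eq_same] at hj
  exact Prod.ext rfl (Units.ext hj)

theorem everHitProb_eq_one_of_reflTransGen {p : Dir d → ℝ} (hp : ∀ e, 0 < p e)
    {Z : (latticeGraph d).Subgraph} {z x : Site d}
    (h : stepOp p Z (everHitProb p Z z) z = 1) (hx : Relation.ReflTransGen Z.Adj z x) :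
    everHitProb p Z z x = 1 := by
  induction hx with
  | refl => exact everHitProb_self p Z z
  | @tail x y _ hxy ih =>
    obtain ⟨e, he⟩ := exists_dir_of_adj hxy.adj_sub
    refine eq_one_of_stepOp_eq_one hp (everHitProb_le_one hp Z z) ?_ he hxy
    rcases eq_or_ne x z with rfl | hne
    · exact h
    · rwa [← everHitProb_of_ne hp Z hne]

/-- A connected subgraph of the lattice which infinitely many single edges of bounded conductance
cut into finite pieces is recurrent. -/
theorem tendsto_hitProb_one {p : Dir d → ℝ} (hp : ∀ e, 0 < p e)
    {Z : (latticeGraph d).Subgraph} {o : Site d} (ho : ∃ y, Z.Adj o y)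
    (hconn : ∀ x ∈ Z.verts, Relation.ReflTransGen Z.Adj o x) {T : Set ℕ}
    (hT : T.Infinite) {A : ℕ → Finset (Site d)} {a b : ℕ → Site d}
    (hcut : ∀ n ∈ T, IsCut Z (A n) (a n) (b n)) (ha : Set.InjOn a T)
    (hA : ∀ z ∈ Z.verts, ∃ n₀, ∀ n ∈ T, n₀ ≤ n → z ∈ A n)
    {M : ℝ} (hM : ∀ n ∈ T, conductance p Z (a n) (b n) ≤ M)
    {z x : Site d} (hz : z ∈ Z.verts) (hx : x ∈ Z.verts) :
    Tendsto (fun n => hitProb p Z z n x) atTop (𝓝 1) := by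
  have hsymm : Std.Symm Z.Adj := ⟨fun _ _ h => h.symm⟩
  have hnbr : ∃ y, Z.Adj z y := by
    rcases Relation.ReflTransGen.cases_tail (hconn z hz) with h | ⟨y, -, hy⟩
    · exact h ▸ ho
    · exact ⟨y, hy.symm⟩
  obtain ⟨y, hy⟩ := hnbr
  obtain ⟨e, rfl⟩ := exists_dir_of_adj hy.adj_sub
  have hw : 0 < vertexWeight p Z z := by
    refine Finset.sum_pos' (fun e _ => stepWeight_nonneg hp Z z e) ⟨e, Finset.mem_univ _, ?_⟩
    rw [stepWeight, if_pos hy]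
    exact mul_pos (hp e) (Real.exp_pos _)
  obtain ⟨n₀, hn₀⟩ := hA z hz
  -- The finitely many cuts before `n₀`, which may fail to enclose `z`, are discarded.
  have hT' : (T ∩ Set.Ici n₀).Infinite := by
    intro hfin
    refine hT ((hfin.union (Set.finite_lt_nat n₀)).subset fun n hn => ?_)
    rcases lt_or_ge n n₀ with h | h
    · exact Or.inr h
    · exact Or.inl ⟨hn, h⟩
  have h1 := stepOp_everHitProb_eq_one hp hw hT' (fun n hn => hcut n hn.1)
    (ha.mono Set.inter_subset_left) (fun n hn => hn₀ n hn.1 hn.2) fun n hn => hM n hn.1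
  have h2 : Relation.ReflTransGen Z.Adj z x :=
    (Relation.ReflTransGen.stdSymm.symm _ _ (hconn z hz)).trans (hconn x hx)
  rw [← everHitProb_eq_one_of_reflTransGen hp h1 h2]
  exact tendsto_hitProb hp Z z x

end Recurrence
-- From hitting probabilities on a fixed graph to the walk on a random graph.
section RandomGraph

open MeasureTheory ProbabilityTheory Filter Topology

variable {d : ℕ}

theorem measurable_stepProb {Ω : Type*} [MeasurableSpace Ω] (p : Dir d → ℝ)
    {Z : Ω → (latticeGraph d).Subgraph} (hZ : ∀ x y, MeasurableSet {ω | (Z ω).Adj x y})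
    (x : Site d) (e : Dir d) : Measurable fun ω => stepProb p (Z ω) x e := by
  classical
  unfold stepProb
  refine Measurable.ite (hZ _ _) (measurable_const.div ?_) measurable_const
  exact Finset.measurable_sum _ fun e' _ =>
    Measurable.ite (hZ _ _) measurable_const measurable_const

theorem measurable_hitProb {Ω : Type*} [MeasurableSpace Ω] (p : Dir d → ℝ)
    {Z : Ω → (latticeGraph d).Subgraph} (hZ : ∀ x y, MeasurableSet {ω | (Z ω).Adj x y})
    (z : Site d) (n : ℕ) (x : Site d) : Measurable fun ω => hitProb p (Z ω) z n x := by
  induction n generalizing x with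
  | zero => exact measurable_const
  | succ n ih =>
    by_cases h : x = z
    · simp only [hitProb, h, if_true]
      exact measurable_const
    · simp only [hitProb_succ_of_ne p _ h, stepOp]
      exact Finset.measurable_sum _ fun e _ => (measurable_stepProb p hZ x e).mul (ih _)

theorem measurable_comp_site {Ω : Type*} [MeasurableSpace Ω] {g : Ω → Site d → ℝ}
    (hg : ∀ x, Measurable fun ω => g ω x) {Y : Ω → Site d} (hY : Measurable Y) :
    Measurable fun ω => g ω (Y ω) := by
  have h : Measurable fun q : Site d × Ω => g q.2 q.1 :=
    measurable_from_prod_countable_right hg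
  exact h.comp (hY.prodMk measurable_id)

theorem measurableSet_comp_site {Ω : Type*} [MeasurableSpace Ω] {s : Site d → Set Ω}
    (hs : ∀ x, MeasurableSet (s x)) {Y : Ω → Site d} (hY : Measurable Y) :
    MeasurableSet {ω | ω ∈ s (Y ω)} := by
  have : {ω | ω ∈ s (Y ω)} = ⋃ x, s x ∩ Y ⁻¹' {x} := by
    ext ω
    simp
  rw [this]
  exact MeasurableSet.iUnion fun x => (hs x).inter (hY (measurableSet_singleton x))

variable {Ω : Type*} {𝒢 mΩ : MeasurableSpace Ω} {μ : Measure Ω}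

theorem measurable_of_pastSigma {Y : ℕ → Ω → Site d} {m n : ℕ} (h : m ≤ n)
    (𝒢 : MeasurableSpace Ω) : Measurable[𝒢 ⊔ pastSigma Y n] (Y m) := by
  refine Measurable.mono (comap_measurable (Y m)) ?_ le_rfl
  exact le_sup_of_le_right (le_iSup₂_of_le m h le_rfl)

theorem sup_pastSigma_le {Y : ℕ → Ω → Site d} (hY : ∀ n, Measurable (Y n))
    (h𝒢 : 𝒢 ≤ mΩ) (n : ℕ) : 𝒢 ⊔ pastSigma Y n ≤ mΩ :=
  sup_le h𝒢 (iSup₂_le fun m _ => (hY m).comap_le)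

theorem sup_pastSigma_mono (Y : ℕ → Ω → Site d) (𝒢 : MeasurableSpace Ω) {m n : ℕ} (h : m ≤ n) :
    𝒢 ⊔ pastSigma Y m ≤ 𝒢 ⊔ pastSigma Y n :=
  sup_le_sup le_rfl (iSup₂_le fun k hk =>
    le_iSup₂_of_le (f := fun k _ => MeasurableSpace.comap (Y k) inferInstance)
      k (hk.trans h) le_rfl)

theorem le_sup_pastSigma (Y : ℕ → Ω → Site d) (𝒢 : MeasurableSpace Ω) (n : ℕ) :
    𝒢 ≤ 𝒢 ⊔ pastSigma Y n :=
  le_sup_left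

theorem measurableSet_step {Y : ℕ → Ω → Site d} (hY : ∀ n, Measurable (Y n)) (n : ℕ)
    (e : Dir d) : MeasurableSet {ω | Y (n + 1) ω = Y n ω + e.vec} :=
  measurableSet_eq_fun (hY _) ((hY n).add_const _)

section Walk

variable [IsProbabilityMeasure μ] {p : Dir d → ℝ} {Z : Ω → (latticeGraph d).Subgraph}
  {Y : ℕ → Ω → Site d}

/-- The integrated Markov property, tested against bounded functions of the graph information and
the past; later arguments use the transition law in this form. -/
theorem IsRandomWalkOn.integral_mul_step (h : IsRandomWalkOn μ p Z 𝒢 Y) (h𝒢 : 𝒢 ≤ mΩ)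
    (hY : ∀ n, Measurable (Y n)) {n : ℕ} (e : Dir d) {g : Ω → ℝ}
    (hg : Measurable[𝒢 ⊔ pastSigma Y n] g) {K : ℝ} (hK : ∀ ω, |g ω| ≤ K) :
    ∫ ω, g ω * Set.indicator {ω | Y (n + 1) ω = Y n ω + e.vec} (fun _ => (1 : ℝ)) ω ∂μ =
      ∫ ω, g ω * stepProb p (Z ω) (Y n ω) e ∂μ := by
  have hm := sup_pastSigma_le hY h𝒢 n
  have hs := measurableSet_step hY n e
  have hint : Integrable (Set.indicator {ω | Y (n + 1) ω = Y n ω + e.vec} (fun _ => (1 : ℝ))) μ :=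
    (integrable_const _).indicator hs
  have hgint : Integrable (fun ω => g ω *
      Set.indicator {ω | Y (n + 1) ω = Y n ω + e.vec} (fun _ => (1 : ℝ)) ω) μ :=
    hint.bdd_mul (hg.mono hm le_rfl).aestronglyMeasurable (Eventually.of_forall hK)
  have h1 := condExp_mul_of_stronglyMeasurable_left (μ := μ) (m := 𝒢 ⊔ pastSigma Y n)
    hg.stronglyMeasurable hgint hint
  calc _ = ∫ ω, (μ[g * Set.indicator {ω | Y (n + 1) ω = Y n ω + e.vec} (fun _ => (1 : ℝ)) |
        𝒢 ⊔ pastSigma Y n]) ω ∂μ := (integral_condExp hm).symm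
    _ = _ := by
      refine integral_congr_ae ?_
      filter_upwards [h1, h.step n e] with ω h1 h2
      rw [h1, Pi.mul_apply, h2]

/-- The disjoint events of stepping along an edge in direction `e` have as total probability the
mean of the sum of the step probabilities, which is one. -/
theorem IsRandomWalkOn.ae_adj_succ (h : IsRandomWalkOn μ p Z 𝒢 Y) (hp : ∀ e, 0 < p e)
    (h𝒢 : 𝒢 ≤ mΩ) (hY : ∀ n, Measurable (Y n))
    (hZ : ∀ x y, MeasurableSet[𝒢] {ω | (Z ω).Adj x y}) {n : ℕ}
    (hn : ∀ᵐ ω ∂μ, ∃ y, (Z ω).Adj (Y n ω) y) :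
    ∀ᵐ ω ∂μ, (Z ω).Adj (Y n ω) (Y (n + 1) ω) := by
  classical
  have hm := sup_pastSigma_le hY h𝒢 n
  have hadj : ∀ e : Dir d, MeasurableSet[𝒢 ⊔ pastSigma Y n]
      {ω | (Z ω).Adj (Y n ω) (Y n ω + e.vec)} := fun e =>
    @measurableSet_comp_site d Ω (𝒢 ⊔ pastSigma Y n) (fun x => {ω | (Z ω).Adj x (x + e.vec)})
      (fun x => le_sup_pastSigma Y 𝒢 n _ (hZ _ _)) _ (measurable_of_pastSigma le_rfl 𝒢)
  let Q : Dir d → Set Ω := fun e =>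
    {ω | (Z ω).Adj (Y n ω) (Y n ω + e.vec)} ∩ {ω | Y (n + 1) ω = Y n ω + e.vec}
  have hQ : ∀ e, MeasurableSet (Q e) := fun e => (hm _ (hadj e)).inter (measurableSet_step hY n e)
  have hdisj : Pairwise (Function.onFun Disjoint Q) := by
    intro e e' hne
    refine Set.disjoint_left.2 fun ω h1 h2 => hne (Dir.vec_injective ?_)
    exact add_left_cancel (h1.2.symm.trans h2.2)
  have hreal : ∀ e, μ.real (Q e) = ∫ ω, stepProb p (Z ω) (Y n ω) e ∂μ := by
    intro e
    have h1 := h.integral_mul_step h𝒢 hY (n := n) e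
      (g := Set.indicator {ω | (Z ω).Adj (Y n ω) (Y n ω + e.vec)} fun _ => (1 : ℝ))
      (measurable_const.indicator (hadj e)) (K := 1) (fun ω => by
        by_cases hω : (Z ω).Adj (Y n ω) (Y n ω + e.vec) <;> simp [Set.indicator, hω])
    rw [← integral_indicator_one (hQ e)]
    refine Eq.trans (integral_congr_ae (Eventually.of_forall fun ω => ?_))
      (h1.trans (integral_congr_ae (Eventually.of_forall fun ω => ?_)))
    · by_cases h1 : (Z ω).Adj (Y n ω) (Y n ω + e.vec) <;>
        by_cases h2 : Y (n + 1) ω = Y n ω + e.vec <;> simp [Q, Set.indicator, h1, h2]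
    · by_cases h1 : (Z ω).Adj (Y n ω) (Y n ω + e.vec) <;> simp [stepProb, Set.indicator, h1]
  have hone : μ.real (⋃ e, Q e) = 1 := by
    rw [measureReal_iUnion_fintype hdisj hQ, Finset.sum_congr rfl fun e _ => hreal e,
      ← integral_finsetSum]
    · have : ∀ᵐ ω ∂μ, ∑ e, stepProb p (Z ω) (Y n ω) e = (1 : ℝ) := by
        filter_upwards [hn] with ω ⟨y, hy⟩
        obtain ⟨e, rfl⟩ := exists_dir_of_adj hy.adj_sub
        exact sum_stepProb hp _ _ hy
      rw [integral_congr_ae this]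
      simp
    · intro e _
      refine Integrable.of_bound (C := 1) ?_ (Eventually.of_forall fun ω => ?_)
      · exact (measurable_comp_site (g := fun ω x => stepProb p (Z ω) x e)
          (fun x => measurable_stepProb p (fun x y => h𝒢 _ (hZ x y)) x e)
          (hY n)).aestronglyMeasurable
      · rw [Real.norm_of_nonneg (stepProb_nonneg hp _ _ _)]
        exact (Finset.single_le_sum (fun e _ => stepProb_nonneg hp (Z ω) (Y n ω) e)
          (Finset.mem_univ e)).trans (sum_stepProb_le_one hp _ _)
  have hae : ∀ᵐ ω ∂μ, ω ∈ ⋃ e, Q e := 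
    (mem_ae_iff_prob_eq_one (MeasurableSet.iUnion hQ)).2 ((ENNReal.toReal_eq_one_iff _).1 hone)
  filter_upwards [hae] with ω hω
  obtain ⟨e, he⟩ := Set.mem_iUnion.1 hω
  have h2 : Y (n + 1) ω = Y n ω + e.vec := he.2
  rw [h2]
  exact he.1

theorem IsRandomWalkOn.ae_adj (h : IsRandomWalkOn μ p Z 𝒢 Y) (hp : ∀ e, 0 < p e)
    (h𝒢 : 𝒢 ≤ mΩ) (hY : ∀ n, Measurable (Y n))
    (hZ : ∀ x y, MeasurableSet[𝒢] {ω | (Z ω).Adj x y})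
    (h0 : ∀ᵐ ω ∂μ, ∃ y, (Z ω).Adj 0 y) :
    ∀ᵐ ω ∂μ, ∀ n, (Z ω).Adj (Y n ω) (Y (n + 1) ω) := by
  refine ae_all_iff.2 fun n => ?_
  induction n with
  | zero =>
    refine h.ae_adj_succ hp h𝒢 hY hZ ?_
    filter_upwards [h0, h.start] with ω h1 h2
    rwa [h2]
  | succ n ih =>
    refine h.ae_adj_succ hp h𝒢 hY hZ ?_
    filter_upwards [ih] with ω hω
    exact ⟨_, hω.symm⟩

/-- First-step analysis by induction on `N`. The time `n` and the past event `B` stay general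
because the induction hypothesis is applied at time `n + 1`, to `B` intersected with the event of
not being at `z`. -/
theorem IsRandomWalkOn.measureReal_avoid_le (h : IsRandomWalkOn μ p Z 𝒢 Y) (hp : ∀ e, 0 < p e)
    (h𝒢 : 𝒢 ≤ mΩ) (hY : ∀ n, Measurable (Y n))
    (hZ : ∀ x y, MeasurableSet[𝒢] {ω | (Z ω).Adj x y})
    (hadj : ∀ᵐ ω ∂μ, ∀ n, (Z ω).Adj (Y n ω) (Y (n + 1) ω)) (z : Site d) (N : ℕ) :
    ∀ (n : ℕ) (B : Set Ω), MeasurableSet[𝒢 ⊔ pastSigma Y n] B →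
      μ.real (B ∩ {ω | ∀ k ≤ N, Y (n + k) ω ≠ z}) ≤
        ∫ ω in B, (1 - hitProb p (Z ω) z N (Y n ω)) ∂μ := by
  classical
  have hmeas : ∀ N n, Measurable fun ω => hitProb p (Z ω) z N (Y n ω) := fun N n =>
    measurable_comp_site (measurable_hitProb p (fun x y => h𝒢 _ (hZ x y)) z N) (hY n)
  have hintg : ∀ N n, Integrable (fun ω => 1 - hitProb p (Z ω) z N (Y n ω)) μ := fun N n =>
    Integrable.of_bound (C := 1) (measurable_const.sub (hmeas N n)).aestronglyMeasurable
      (Eventually.of_forall fun ω => by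
        have h1 := hitProb_nonneg hp (Z ω) z N (Y n ω)
        have h2 := hitProb_le_one hp (Z ω) z N (Y n ω)
        rw [Real.norm_eq_abs, abs_le]
        constructor <;> linarith)
  induction N with
  | zero =>
    intro n B hB
    have hm := sup_pastSigma_le hY h𝒢 n
    have hset : MeasurableSet {ω | ∀ k ≤ 0, Y (n + k) ω ≠ z} := by
      simp only [nonpos_iff_eq_zero, forall_eq, add_zero]
      exact (hY n (measurableSet_singleton z)).compl
    rw [← integral_indicator_one ((hm _ hB).inter hset), ← integral_indicator (hm _ hB)]
    refine le_of_eq (integral_congr_ae (Eventually.of_forall fun ω => ?_))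
    by_cases h1 : ω ∈ B <;> by_cases h2 : Y n ω = z <;> simp [Set.indicator, hitProb, h1, h2]
  | succ N ih =>
    intro n B hB
    have hm := sup_pastSigma_le hY h𝒢 n
    set B' := B ∩ {ω | Y n ω ≠ z} with hB'
    have hB'm : MeasurableSet[𝒢 ⊔ pastSigma Y n] B' :=
      hB.inter (measurable_of_pastSigma le_rfl 𝒢 (measurableSet_singleton z)).compl
    have hset : B ∩ {ω | ∀ k ≤ N + 1, Y (n + k) ω ≠ z} =
        B' ∩ {ω | ∀ k ≤ N, Y (n + 1 + k) ω ≠ z} := by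
      ext ω
      simp only [hB', Set.mem_inter_iff, Set.mem_ofPred_eq, and_assoc]
      refine and_congr_right fun _ => ⟨fun hk => ⟨hk 0 (by omega), fun k hkN => ?_⟩,
        fun hk k hkN => ?_⟩
      · have := hk (k + 1) (by omega)
        rwa [show n + 1 + k = n + (k + 1) by omega]
      · rcases k with _ | k
        · exact hk.1
        · have := hk.2 k (by omega)
          rwa [show n + (k + 1) = n + 1 + k by omega]
    rw [hset]
    refine (ih (n + 1) B' (sup_pastSigma_mono Y 𝒢 (Nat.le_succ n) _ hB'm)).trans ?_
    set g : Dir d → Ω → ℝ := fun e =>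
      B'.indicator fun ω => 1 - hitProb p (Z ω) z N (Y n ω + e.vec) with hg
    have hgm : ∀ e, Measurable[𝒢 ⊔ pastSigma Y n] (g e) := by
      intro e
      refine Measurable.indicator (measurable_const.sub ?_) hB'm
      exact @measurable_comp_site d Ω (𝒢 ⊔ pastSigma Y n) _ (@measurable_hitProb d Ω
        (𝒢 ⊔ pastSigma Y n) p _ (fun x y => le_sup_pastSigma Y 𝒢 n _ (hZ x y)) z N) _
        ((measurable_of_pastSigma le_rfl 𝒢).add_const _)
    have hgb : ∀ e ω, 0 ≤ g e ω ∧ g e ω ≤ 1 := by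
      intro e ω
      have h1 := hitProb_nonneg hp (Z ω) z N (Y n ω + e.vec)
      have h2 := hitProb_le_one hp (Z ω) z N (Y n ω + e.vec)
      by_cases hω : ω ∈ B' <;> simp [hg, hω, h1, h2]
    have hgb' : ∀ e ω, |g e ω| ≤ 1 := fun e ω => abs_le.2 ⟨by linarith [hgb e ω], (hgb e ω).2⟩
    -- Splitting by the direction of the next step leaves factors `g e` that depend only on the
    -- graph and the past, so the Markov property applies to each.
    have hsplit : ∀ᵐ ω ∂μ, B'.indicator (fun ω => 1 - hitProb p (Z ω) z N (Y (n + 1) ω)) ω =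
        ∑ e, g e ω * Set.indicator {ω | Y (n + 1) ω = Y n ω + e.vec} (fun _ => (1 : ℝ)) ω := by
      filter_upwards [hadj] with ω hω
      obtain ⟨e₀, he₀⟩ := exists_dir_of_adj (hω n).adj_sub
      rw [Finset.sum_eq_single e₀]
      · simp [hg, Set.indicator, he₀]
      · intro e _ hne
        have : ¬ Y (n + 1) ω = Y n ω + e.vec := fun h' =>
          hne (Dir.vec_injective (add_left_cancel (h'.symm.trans he₀)))
        simp [Set.indicator, this]
      · simp
    have hspm : ∀ e, Measurable fun ω => stepProb p (Z ω) (Y n ω) e := fun e =>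
      measurable_comp_site (g := fun ω x => stepProb p (Z ω) x e)
        (fun x => measurable_stepProb p (fun x y => h𝒢 _ (hZ x y)) x e) (hY n)
    have hsp1 : ∀ e ω, stepProb p (Z ω) (Y n ω) e ≤ 1 := fun e ω =>
      (Finset.single_le_sum (fun e _ => stepProb_nonneg hp (Z ω) (Y n ω) e)
        (Finset.mem_univ e)).trans (sum_stepProb_le_one hp _ _)
    have hint2 : ∀ e, Integrable (fun ω => g e ω * stepProb p (Z ω) (Y n ω) e) μ := by
      intro e
      refine Integrable.of_bound (C := 1)
        (((hgm e).mono hm le_rfl).mul (hspm e)).aestronglyMeasurable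
        (Eventually.of_forall fun ω => ?_)
      rw [Real.norm_of_nonneg (mul_nonneg (hgb e ω).1 (stepProb_nonneg hp _ _ _))]
      exact mul_le_one₀ (hgb e ω).2 (stepProb_nonneg hp _ _ _) (hsp1 e ω)
    have hint1 : ∀ e, Integrable (fun ω => g e ω *
        Set.indicator {ω | Y (n + 1) ω = Y n ω + e.vec} (fun _ => (1 : ℝ)) ω) μ := by
      intro e
      exact ((integrable_const (1 : ℝ)).indicator (measurableSet_step hY n e)).bdd_mul
        ((hgm e).mono hm le_rfl).aestronglyMeasurable (Eventually.of_forall (hgb' e))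
    rw [← integral_indicator (hm _ hB'm), integral_congr_ae hsplit,
      integral_finsetSum _ fun e _ => hint1 e,
      Finset.sum_congr rfl fun e _ => h.integral_mul_step h𝒢 hY e (hgm e) (hgb' e),
      ← integral_finsetSum _ fun e _ => hint2 e, ← integral_indicator (hm _ hB)]
    refine integral_mono (integrable_finsetSum _ fun e _ => hint2 e)
      ((hintg (N + 1) n).indicator (hm _ hB)) fun ω => ?_
    by_cases hωB : ω ∈ B
    · by_cases hz : Y n ω = z
      · have : ω ∉ B' := fun h' => h'.2 hz
        simp [hg, this, hωB, hz, hitProb_self]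
      · have : ω ∈ B' := ⟨hωB, hz⟩
        have h1 := sum_stepProb_le_one hp (Z ω) (Y n ω)
        simp only [hg, Set.indicator_of_mem this, Set.indicator_of_mem hωB,
          hitProb_succ_of_ne p (Z ω) hz, stepOp, sub_mul, one_mul, Finset.sum_sub_distrib]
        have h2 : ∀ e, hitProb p (Z ω) z N (Y n ω + e.vec) * stepProb p (Z ω) (Y n ω) e =
          stepProb p (Z ω) (Y n ω) e * hitProb p (Z ω) z N (Y n ω + e.vec) := fun e => mul_comm _ _
        simp only [h2]
        linarith
    · have : ω ∉ B' := fun h' => hωB h'.1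
      simp [hg, this, hωB]

/-- A random walk on a random graph all of whose hitting probabilities are equal to one visits
every vertex infinitely often. -/
theorem IsRandomWalkOn.isRecurrentOn (h : IsRandomWalkOn μ p Z 𝒢 Y) (hp : ∀ e, 0 < p e)
    (h𝒢 : 𝒢 ≤ mΩ) (hY : ∀ n, Measurable (Y n))
    (hZ : ∀ x y, MeasurableSet[𝒢] {ω | (Z ω).Adj x y})
    (hV : ∀ x, MeasurableSet[𝒢] {ω | x ∈ (Z ω).verts})
    (h0 : ∀ᵐ ω ∂μ, ∃ y, (Z ω).Adj 0 y)
    (hhit : ∀ᵐ ω ∂μ, ∀ z ∈ (Z ω).verts, ∀ x ∈ (Z ω).verts,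
      Tendsto (fun N => hitProb p (Z ω) z N x) atTop (𝓝 1)) :
    IsRecurrentOn μ Z Y := by
  classical
  have hadj := h.ae_adj hp h𝒢 hY hZ h0
  have hmeas : ∀ z N n, Measurable fun ω => hitProb p (Z ω) z N (Y n ω) := fun z N n =>
    measurable_comp_site (measurable_hitProb p (fun x y => h𝒢 _ (hZ x y)) z N) (hY n)
  -- Avoiding `z` forever after time `n` is contained in avoiding it for `N` steps, and that bound
  -- tends to zero by dominated convergence.
  have hnull : ∀ z n, μ ({ω | z ∈ (Z ω).verts} ∩ {ω | ∀ k, Y (n + k) ω ≠ z}) = 0 := by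
    intro z n
    set B := {ω | z ∈ (Z ω).verts} with hB
    have hBm : MeasurableSet B := h𝒢 _ (hV z)
    have hle : ∀ N, μ.real (B ∩ {ω | ∀ k, Y (n + k) ω ≠ z}) ≤
        ∫ ω, B.indicator (fun ω => 1 - hitProb p (Z ω) z N (Y n ω)) ω ∂μ := by
      intro N
      rw [integral_indicator hBm]
      refine le_trans (measureReal_mono ?_) (h.measureReal_avoid_le hp h𝒢 hY hZ hadj z N n B
        (le_sup_pastSigma Y 𝒢 n _ (hV z)))
      exact Set.inter_subset_inter_right _ fun ω hω k _ => hω k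
    have hlim : Tendsto (fun N => ∫ ω, B.indicator
        (fun ω => 1 - hitProb p (Z ω) z N (Y n ω)) ω ∂μ) atTop (𝓝 (∫ ω, (0 : ℝ) ∂μ)) := by
      refine tendsto_integral_of_dominated_convergence (fun _ => 1) (fun N => ?_)
        (integrable_const _) (fun N => Eventually.of_forall fun ω => ?_) ?_
      · exact ((measurable_const.sub (hmeas z N n)).indicator hBm).aestronglyMeasurable
      · have h1 := hitProb_nonneg hp (Z ω) z N (Y n ω)
        have h2 := hitProb_le_one hp (Z ω) z N (Y n ω)
        by_cases hω : ω ∈ B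
        · rw [Set.indicator_of_mem hω, Real.norm_eq_abs, abs_le]
          constructor <;> linarith
        · simp [hω]
      · filter_upwards [hhit, hadj] with ω h1 h2
        by_cases hω : ω ∈ B
        · simp only [Set.indicator_of_mem hω]
          simpa using (h1 z hω (Y n ω) ((h2 n).fst_mem)).const_sub 1
        · simp [hω]
    rw [integral_zero] at hlim
    have := ge_of_tendsto' hlim hle
    exact (measureReal_eq_zero_iff).1 (le_antisymm this measureReal_nonneg)
  have hall : ∀ᵐ ω ∂μ, ∀ z n, ¬ (z ∈ (Z ω).verts ∧ ∀ k, Y (n + k) ω ≠ z) :=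
    ae_all_iff.2 fun z => ae_all_iff.2 fun n => measure_eq_zero_iff_ae_notMem.1 (hnull z n)
  filter_upwards [hall, h0] with ω hω ⟨y, hy⟩
  refine ⟨hy.fst_mem, fun x hx => frequently_atTop.2 fun n => ?_⟩
  have := hω x n
  push Not at this
  obtain ⟨k, hk⟩ := this hx
  exact ⟨n + k, Nat.le_add_right _ _, hk⟩

end Walk

end RandomGraph
-- Cut times of random walks with independent, identically distributed steps.
section CutTimes

open MeasureTheory ProbabilityTheory Filter Topology

variable {Ω : Type*} {mΩ : MeasurableSpace Ω} {μ : Measure Ω} [IsProbabilityMeasure μ]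

/-- A random walk whose steps have a nonpositive mean and a finite variance is nonpositive with a
probability which is bounded below along infinitely many times. -/
theorem exists_frequently_le_measure_sum_nonpos {V : ℕ → Ω → ℝ} (hindep : iIndepFun V μ)
    (hident : ∀ i, IdentDistrib (V i) (V 0) μ μ) (hV : MemLp (V 0) 2 μ) (hmean : μ[V 0] ≤ 0) :
    ∃ c : ENNReal, 0 < c ∧ ∃ᶠ n in atTop, c ≤ μ {ω | ∑ i ∈ Finset.range n, V i ω ≤ 0} := by
  -- With zero variance the steps are almost surely a nonpositive constant; otherwise the central
  -- limit theorem has a nondegenerate limit.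
  by_cases hvar : Var[V 0; μ] = 0
  · refine ⟨1, one_pos, Frequently.of_forall fun n => ?_⟩
    have h : ∀ᵐ ω ∂μ, ∀ i, V i ω = μ[V 0] := by
      refine ae_all_iff.2 fun i => ?_
      have := ae_eq_integral_of_variance_eq_zero ((hident i).memLp_iff.2 hV)
        ((hident i).variance_eq.trans hvar)
      filter_upwards [this] with ω hω
      rw [hω, (hident i).integral_eq]
    have h' : ∀ᵐ ω ∂μ, ω ∈ {ω | ∑ i ∈ Finset.range n, V i ω ≤ 0} := by
      filter_upwards [h] with ω hω
      exact Finset.sum_nonpos fun i _ => (hω i).trans_le hmean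
    exact ((measure_eq_measure_of_null_sdiff (Set.subset_univ _)
      (by rw [← Set.compl_eq_univ_sdiff]; exact h')).trans measure_univ).ge
  · set v := Var[V 0; μ].toNNReal
    have hv : v ≠ 0 := fun h => hvar (le_antisymm (Real.toNNReal_eq_zero.1 h) (variance_nonneg _ _))
    have hclt := tendstoInDistribution_inv_sqrt_mul_sum_sub (Y := id)
      (P' := gaussianReal 0 v) HasLaw.id hV hindep hident
    -- Portmanteau on the open half-line of negative numbers, which the Gaussian limit charges.
    -- Centring costs nothing, as the mean is nonpositive.
    have hle := ProbabilityMeasure.le_liminf_measure_open_of_tendsto hclt.tendsto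
      (isOpen_Iio (a := (0 : ℝ)))
    simp only [ProbabilityMeasure.coe_mk, Measure.map_id] at hle
    have hpos : 0 < gaussianReal 0 v (Set.Iio 0) := by
      refine pos_iff_ne_zero.2 fun h => ?_
      have := gaussianReal_absolutelyContinuous' 0 hv h
      simp at this
    obtain ⟨c, hc0, hc⟩ := exists_between hpos
    refine ⟨c, hc0, Eventually.frequently ?_⟩
    filter_upwards [eventually_lt_of_lt_liminf (hc.trans_le hle)] with n hn
    refine hn.le.trans ?_
    rw [Measure.map_apply_of_aemeasurable (hclt.forall_aemeasurable n) measurableSet_Iio]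
    refine measure_mono fun ω hω => ?_
    have hω : (√(n : ℝ))⁻¹ * (∑ k ∈ Finset.range n, V k ω - n * μ[V 0]) < 0 := hω
    have h1 : ∑ k ∈ Finset.range n, V k ω - n * μ[V 0] < 0 := by
      by_contra! h
      exact absurd hω (not_lt.2 (mul_nonneg (by positivity) h))
    have h2 : (n : ℝ) * μ[V 0] ≤ 0 := mul_nonpos_of_nonneg_of_nonpos (by positivity) hmean
    change ∑ i ∈ Finset.range n, V i ω ≤ 0
    linarith

/-- Continuity from above of a finite measure along the unions of the tails. -/
theorem le_measure_frequently {D : ℕ → Set Ω} (hD : ∀ n, MeasurableSet (D n)) {c : ENNReal}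
    (h : ∃ᶠ n in atTop, c ≤ μ (D n)) : c ≤ μ {ω | ∃ᶠ n in atTop, ω ∈ D n} := by
  have heq : {ω | ∃ᶠ n in atTop, ω ∈ D n} = ⋂ N, ⋃ n, ⋃ (_ : N ≤ n), D n := by
    ext ω
    simp [frequently_atTop]
  rw [heq]
  refine ge_of_tendsto' (tendsto_measure_iInter_atTop (μ := μ) (fun N => ?_) ?_
    ⟨0, measure_ne_top _ _⟩) fun N => ?_
  · exact (MeasurableSet.iUnion fun n => MeasurableSet.iUnion fun _ => hD n).nullMeasurableSet
  · exact fun N N' hN => Set.iUnion_mono fun n => Set.iUnion_mono' fun hn => ⟨hN.trans hn, le_rfl⟩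
  · obtain ⟨n, hn, hc⟩ := frequently_atTop.1 h N
    exact hc.trans (measure_mono (Set.subset_iUnion₂_of_subset n hn le_rfl))

variable {E : Type*}

/-- The increment over the time interval `[m, n)` of the walk with the steps `f (ξ i)`. -/
def blockSum (f : E → ℝ) (ξ : ℕ → Ω → E) (m n : ℕ) (ω : Ω) : ℝ :=
  ∑ i ∈ Finset.Ico m n, f (ξ i ω)

theorem blockSum_add (f : E → ℝ) (ξ : ℕ → Ω → E) {k m n : ℕ} (h1 : k ≤ m) (h2 : m ≤ n) (ω : Ω) :
    blockSum f ξ k m ω + blockSum f ξ m n ω = blockSum f ξ k n ω :=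
  Finset.sum_Ico_consecutive _ h1 h2

variable [MeasurableSpace E]

theorem measurable_blockSum {f : E → ℝ} (hf : Measurable f) (ξ : ℕ → Ω → E) {m n : ℕ} {s : Set ℕ}
    (hs : Set.Ico m n ⊆ s) :
    Measurable[⨆ i ∈ s, MeasurableSpace.comap (ξ i) inferInstance] (blockSum f ξ m n) := by
  refine Finset.measurable_sum _ fun i hi => hf.comp ?_
  exact Measurable.mono (comap_measurable (ξ i))
    (le_iSup₂_of_le (f := fun i _ => MeasurableSpace.comap (ξ i) inferInstance) i
      (hs (Finset.mem_Ico.1 hi)) le_rfl) le_rfl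

/-- The time `n` is a strict cut time for the walk with the steps `u (ξ i)`, started at the
time `K`: up to the time `n` the walk is at most, and afterwards it is larger than its value at
the time `n`. -/
def IsCutTime (u : E → ℝ) (ξ : ℕ → Ω → E) (K n : ℕ) (ω : Ω) : Prop :=
  (∀ m, K ≤ m → m ≤ n → 0 ≤ blockSum u ξ m n ω) ∧ ∀ m, n < m → 0 < blockSum u ξ n m ω

theorem measurableSet_isCutTime {u v : E → ℝ} (hu : Measurable u) (hv : Measurable v)
    (ξ : ℕ → Ω → E) (K n : ℕ) (hK : K ≤ n) (C : ℝ) :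
    MeasurableSet[⨆ i ∈ Set.Ici K, MeasurableSpace.comap (ξ i) inferInstance]
      {ω | IsCutTime u ξ K n ω ∧ blockSum v ξ K n ω ≤ C} := by
  have heq : {ω | IsCutTime u ξ K n ω ∧ blockSum v ξ K n ω ≤ C} =
      ((⋂ m, ⋂ (_ : K ≤ m), ⋂ (_ : m ≤ n), {ω | 0 ≤ blockSum u ξ m n ω}) ∩
        ⋂ m, ⋂ (_ : n < m), {ω | 0 < blockSum u ξ n m ω}) ∩ {ω | blockSum v ξ K n ω ≤ C} := by
    ext ω
    simp [IsCutTime]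
  rw [heq]
  refine MeasurableSet.inter (MeasurableSet.inter ?_ ?_) ?_
  · refine MeasurableSet.iInter fun m => MeasurableSet.iInter fun hm => MeasurableSet.iInter
      fun _ => measurableSet_le measurable_const ?_
    exact measurable_blockSum hu ξ fun i hi => le_trans hm hi.1
  · refine MeasurableSet.iInter fun m => MeasurableSet.iInter fun hm =>
      measurableSet_lt measurable_const ?_
    exact measurable_blockSum hu ξ fun i hi => le_trans hK hi.1
  · exact measurableSet_le (measurable_blockSum hv ξ fun i hi => hi.1) measurable_const

theorem iSup_comap_le {ξ : ℕ → Ω → E} (hξ : ∀ i, Measurable (ξ i)) (s : Set ℕ) :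
    ⨆ i ∈ s, MeasurableSpace.comap (ξ i) inferInstance ≤ mΩ :=
  iSup₂_le fun i _ => (hξ i).comap_le

/-- Chernoff bound for large backward moves. -/
theorem measure_blockSum_le {ξ : ℕ → Ω → E} (hξ : ∀ i, Measurable (ξ i)) (hindep : iIndepFun ξ μ)
    (hident : ∀ i, IdentDistrib (ξ i) (ξ 0) μ μ) {u : E → ℝ} (hu : Measurable u) {θ : ℝ}
    (hθ : 0 ≤ θ) (hint : Integrable (fun ω => Real.exp (-θ * u (ξ 0 ω))) μ) (m n : ℕ) (L : ℝ) :
    μ {ω | blockSum u ξ m n ω ≤ -L} ≤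
      ENNReal.ofReal (Real.exp (-θ * L) * mgf (fun ω => u (ξ 0 ω)) μ (-θ) ^ (n - m)) := by
  have hUi : iIndepFun (fun i ω => u (ξ i ω)) μ := hindep.comp (fun _ => u) fun _ => hu
  have hUm : ∀ i, Measurable fun ω => u (ξ i ω) := fun i => hu.comp (hξ i)
  have hUid : ∀ i, IdentDistrib (fun ω => u (ξ i ω)) (fun ω => u (ξ 0 ω)) μ μ :=
    fun i => (hident i).comp hu
  have hb : blockSum u ξ m n = ∑ i ∈ Finset.Ico m n, fun ω => u (ξ i ω) := by
    ext ω
    simp [blockSum]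
  have hint' : ∀ i ∈ Finset.Ico m n, Integrable (fun ω => Real.exp (-θ * u (ξ i ω))) μ :=
    fun i _ => (((hUid i).comp (measurable_const_mul (-θ)).exp).integrable_iff).2 hint
  have h1 := measure_le_le_exp_mul_mgf (μ := μ) (X := blockSum u ξ m n) (-L)
    (neg_nonpos.2 hθ) (by
      rw [hb]
      exact hUi.integrable_exp_mul_sum hUm hint')
  have h2 : mgf (blockSum u ξ m n) μ (-θ) = mgf (fun ω => u (ξ 0 ω)) μ (-θ) ^ (n - m) := by
    rw [hb, hUi.mgf_sum hUm, ← Nat.card_Ico]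
    exact Finset.prod_eq_pow_card fun i _ => mgf_congr_of_identDistrib _ _ (hUid i) _
  rw [h2, show -(-θ) * -L = -θ * L by ring] at h1
  rw [← ofReal_measureReal]
  exact ENNReal.ofReal_le_ofReal h1

/-- Take a time `a` at which the `v`-sum is nonpositive, and force `2 * L` steps `e₀` after it. If
neither the walk before `a` nor the walk after `a + 2 * L` backtracks by `L` or more, the midpoint
`a + L` is a cut time. The forced block is independent of the rest and has a fixed positive
probability. -/
theorem exists_infinite_cut_times_of_pos {ξ : ℕ → Ω → E} (hξ : ∀ i, Measurable (ξ i))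
    (hindep : iIndepFun ξ μ) (hident : ∀ i, IdentDistrib (ξ i) (ξ 0) μ μ)
    {u v : E → ℝ} (hu : Measurable u) (hv : Measurable v) {θ : ℝ} (hθ : 0 < θ)
    (hint : Integrable (fun ω => Real.exp (-θ * u (ξ 0 ω))) μ)
    (hmgf : mgf (fun ω => u (ξ 0 ω)) μ (-θ) < 1)
    {c₀ : ENNReal} (hc₀ : 0 < c₀) (hc : ∃ᶠ n in atTop, c₀ ≤ μ {ω | blockSum v ξ 0 n ω ≤ 0})
    {e₀ : E} (he₀ : MeasurableSet {e₀}) (hue : u e₀ = 1) (hpos : 0 < μ (ξ 0 ⁻¹' {e₀})) :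
    ∃ C : ℝ, 0 < μ {ω | ∃ᶠ n in atTop, IsCutTime u ξ 0 n ω ∧ blockSum v ξ 0 n ω ≤ C} := by
  set ρ := mgf (fun ω => u (ξ 0 ω)) μ (-θ) with hρ
  have hρ0 : 0 ≤ ρ := mgf_nonneg
  have hc₀top : c₀ ≠ ⊤ := by
    obtain ⟨n, hn⟩ := hc.exists
    exact ne_top_of_le_ne_top (measure_ne_top _ _) hn
  -- the probability of a large backward move
  let ε : ℕ → ℝ := fun L => Real.exp (-θ * L) * (1 - ρ)⁻¹
  have hε : Tendsto (fun L : ℕ => ENNReal.ofReal (ε L)) atTop (𝓝 0) := by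
    rw [← ENNReal.ofReal_zero, ← zero_mul (1 - ρ)⁻¹]
    refine ENNReal.tendsto_ofReal (Tendsto.mul_const _ (Real.tendsto_exp_atBot.comp ?_))
    exact tendsto_natCast_atTop_atTop.const_mul_atTop_of_neg (neg_lt_zero.2 hθ)
  have htsum : ∀ L : ℕ, ∑' k : ℕ, ENNReal.ofReal (Real.exp (-θ * L) * ρ ^ k) =
      ENNReal.ofReal (ε L) := by
    intro L
    rw [← ENNReal.ofReal_tsum_of_nonneg (fun k => by positivity)
      ((summable_geometric_of_lt_one hρ0 hmgf).mul_left _), tsum_mul_left,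
      tsum_geometric_of_lt_one hρ0 hmgf]
  -- A quarter of `c₀` for the past and a quarter for the future leave half of `c₀` for the good
  -- event `G`.
  obtain ⟨L, hL⟩ : ∃ L : ℕ, ENNReal.ofReal (ε L) ≤ c₀ / 2 / 2 :=
    (hε.eventually_le_const (ENNReal.half_pos (ENNReal.half_pos hc₀.ne').ne')).exists
  let past : ℕ → Set Ω := fun a => ⋃ k, ⋃ (_ : k ≤ a), {ω | blockSum u ξ (a - k) a ω ≤ -L}
  let fut : ℕ → Set Ω := fun b => ⋃ k, {ω | blockSum u ξ b (b + k) ω ≤ -L}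
  have hpast : ∀ a, μ (past a) ≤ c₀ / 2 / 2 := by
    intro a
    refine ((measure_iUnion_le _).trans ((ENNReal.tsum_le_tsum fun k => ?_).trans
      (htsum L).le)).trans hL
    by_cases hk : k ≤ a
    · simp only [hk, Set.iUnion_true]
      have := measure_blockSum_le hξ hindep hident hu hθ.le hint (a - k) a L
      rwa [Nat.sub_sub_self hk] at this
    · simp [hk]
  have hfut : ∀ b, μ (fut b) ≤ c₀ / 2 / 2 := by
    intro b
    refine ((measure_iUnion_le _).trans ((ENNReal.tsum_le_tsum fun k => ?_).trans
      (htsum L).le)).trans hL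
    have := measure_blockSum_le hξ hindep hident hu hθ.le hint b (b + k) L
    rwa [Nat.add_sub_cancel_left] at this
  let G : ℕ → Set Ω := fun a => {ω | blockSum v ξ 0 a ω ≤ 0} \ (past a ∪ fut (a + 2 * L))
  let F : ℕ → Set Ω := fun a => ⋂ i ∈ Finset.Ico a (a + 2 * L), ξ i ⁻¹' {e₀}
  have hF : ∀ a, μ (F a) = μ (ξ 0 ⁻¹' {e₀}) ^ (2 * L) := by
    intro a
    rw [hindep.measure_inter_preimage_eq_mul (S := Finset.Ico a (a + 2 * L))
      (sets := fun _ => {e₀}) fun _ _ => he₀]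
    rw [Finset.prod_eq_pow_card fun i _ => (hident i).measure_mem_eq he₀, Nat.card_Ico,
      Nat.add_sub_cancel_left]
  have hGle : ∀ a, c₀ ≤ μ {ω | blockSum v ξ 0 a ω ≤ 0} → c₀ / 2 ≤ μ (G a) := by
    intro a ha
    have h1 : μ (past a ∪ fut (a + 2 * L)) ≤ c₀ / 2 := by
      refine (measure_union_le _ _).trans ((add_le_add (hpast a) (hfut _)).trans ?_)
      rw [ENNReal.add_halves]
    calc c₀ / 2 = c₀ - c₀ / 2 := by rw [ENNReal.sub_half hc₀top]
      _ ≤ μ {ω | blockSum v ξ 0 a ω ≤ 0} - μ (past a ∪ fut (a + 2 * L)) := tsub_le_tsub ha h1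
      _ ≤ μ (G a) := le_measure_sdiff
  have hind : ∀ a, μ (F a ∩ G a) = μ (F a) * μ (G a) := by
    intro a
    refine (Indep_iff _ _ μ).1 (indep_iSup_of_disjoint (fun i => (hξ i).comap_le) hindep.iIndep
      (S := Set.Ico a (a + 2 * L)) (T := (Set.Ico a (a + 2 * L))ᶜ) disjoint_compl_right) _ _ ?_ ?_
    · refine Finset.measurableSet_biInter _ fun i hi => ?_
      exact le_iSup₂_of_le (f := fun i _ => MeasurableSpace.comap (ξ i) inferInstance) i
        (Finset.mem_Ico.1 hi) le_rfl _ ⟨_, he₀, rfl⟩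
    · refine MeasurableSet.diff ?_ (MeasurableSet.union ?_ ?_)
      · exact measurableSet_le (measurable_blockSum hv ξ fun i hi => by
          simp only [Set.mem_Ico, Set.mem_compl_iff] at hi ⊢; omega) measurable_const
      · refine MeasurableSet.iUnion fun k => MeasurableSet.iUnion fun hk => ?_
        exact measurableSet_le (measurable_blockSum hu ξ fun i hi => by
          simp only [Set.mem_Ico, Set.mem_compl_iff] at hi ⊢; omega) measurable_const
      · refine MeasurableSet.iUnion fun k => ?_
        exact measurableSet_le (measurable_blockSum hu ξ fun i hi => by
          simp only [Set.mem_Ico, Set.mem_compl_iff] at hi ⊢; omega) measurable_const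
  -- The contribution of the `L` forced steps between `a` and the cut time `a + L`.
  let C : ℝ := L * v e₀
  have hsub : ∀ a, F a ∩ G a ⊆
      {ω | IsCutTime u ξ 0 (a + L) ω ∧ blockSum v ξ 0 (a + L) ω ≤ C} := by
    rintro a ω ⟨hωF, hωG, hωB⟩
    have hstep : ∀ i, a ≤ i → i < a + 2 * L → ξ i ω = e₀ := fun i h1 h2 => by
      have := Set.mem_iInter₂.1 hωF i (Finset.mem_Ico.2 ⟨h1, h2⟩)
      exact this
    have hblock : ∀ (f : E → ℝ) m n, a ≤ m → m ≤ n → n ≤ a + 2 * L →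
        blockSum f ξ m n ω = (n - m : ℕ) * f e₀ := by
      intro f m n h1 h2 h3
      rw [blockSum, Finset.sum_congr rfl fun i hi => by
        rw [hstep i (h1.trans (Finset.mem_Ico.1 hi).1) ((Finset.mem_Ico.1 hi).2.trans_le h3)]]
      simp
    have hωB' : ω ∉ past a ∧ ω ∉ fut (a + 2 * L) := by simpa using hωB
    have hP : ∀ m ≤ a, -(L : ℝ) < blockSum u ξ m a ω := by
      intro m hm
      by_contra! h
      refine hωB'.1 (Set.mem_iUnion₂.2 ⟨a - m, Nat.sub_le _ _, ?_⟩)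
      change blockSum u ξ (a - (a - m)) a ω ≤ -L
      rwa [Nat.sub_sub_self hm]
    have hQ : ∀ m, a + 2 * L ≤ m → -(L : ℝ) < blockSum u ξ (a + 2 * L) m ω := by
      intro m hm
      by_contra! h
      refine hωB'.2 (Set.mem_iUnion.2 ⟨m - (a + 2 * L), ?_⟩)
      change blockSum u ξ (a + 2 * L) (a + 2 * L + (m - (a + 2 * L))) ω ≤ -L
      rwa [Nat.add_sub_cancel' hm]
    refine ⟨⟨fun m _ hm => ?_, fun m hm => ?_⟩, ?_⟩
    · rcases le_or_gt a m with h | h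
      · rw [hblock u m (a + L) h hm (by omega), hue]
        positivity
      · rw [← blockSum_add u ξ h.le (Nat.le_add_right a L),
          hblock u a (a + L) le_rfl (by omega) (by omega), hue, Nat.add_sub_cancel_left]
        linarith [hP m h.le]
    · rcases le_or_gt m (a + 2 * L) with h | h
      · rw [hblock u (a + L) m (by omega) hm.le h, hue, mul_one]
        exact_mod_cast Nat.sub_pos_of_lt hm
      · rw [← blockSum_add u ξ (show a + L ≤ a + 2 * L by omega) h.le,
          hblock u (a + L) (a + 2 * L) (by omega) (by omega) le_rfl, hue,
          show a + 2 * L - (a + L) = L by omega]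
        linarith [hQ m h.le]
    · rw [← blockSum_add v ξ (Nat.zero_le a) (Nat.le_add_right a L),
        hblock v a (a + L) le_rfl (by omega) (by omega), Nat.add_sub_cancel_left]
      have : blockSum v ξ 0 a ω ≤ 0 := hωG
      change _ ≤ (L : ℝ) * v e₀
      linarith
  refine ⟨C, ?_⟩
  have hq : 0 < μ (ξ 0 ⁻¹' {e₀}) ^ (2 * L) * (c₀ / 2) :=
    pos_iff_ne_zero.2 (mul_ne_zero (pow_ne_zero _ hpos.ne') (ENNReal.half_pos hc₀.ne').ne')
  refine hq.trans_le (le_measure_frequently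
    (D := fun n => {ω | IsCutTime u ξ 0 n ω ∧ blockSum v ξ 0 n ω ≤ C})
    (fun n => iSup_comap_le hξ _ _ (measurableSet_isCutTime hu hv ξ 0 n (Nat.zero_le n) C)) ?_)
  refine frequently_atTop.2 fun N => ?_
  obtain ⟨a, haN, ha⟩ := frequently_atTop.1 hc N
  refine ⟨a + L, haN.trans (Nat.le_add_right _ _), ?_⟩
  calc _ ≤ μ (F a) * μ (G a) := by
        rw [hF]
        exact mul_le_mul_right (hGle a ha) _
    _ ≤ _ := by
        rw [← hind]
        exact measure_mono (hsub a)

theorem ae_tendsto_blockSum_atTop {Ω : Type*} {mΩ : MeasurableSpace Ω} {μ : Measure Ω}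
    {ξ : ℕ → Ω → E} (hindep : iIndepFun ξ μ)
    (hident : ∀ i, IdentDistrib (ξ i) (ξ 0) μ μ) {u : E → ℝ} (hu : Measurable u)
    (hint : Integrable (fun ω => u (ξ 0 ω)) μ) (hmean : 0 < ∫ ω, u (ξ 0 ω) ∂μ) :
    ∀ᵐ ω ∂μ, Tendsto (fun n => blockSum u ξ 0 n ω) atTop atTop := by
  have hUi : iIndepFun (fun i ω => u (ξ i ω)) μ := hindep.comp (fun _ => u) fun _ => hu
  have := strong_law_ae_real (fun i ω => u (ξ i ω)) hint (fun i j hij => hUi.indepFun hij)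
    fun i => (hident i).comp hu
  filter_upwards [this] with ω hω
  have h := hω.pos_mul_atTop hmean tendsto_natCast_atTop_atTop
  refine h.congr' ?_
  filter_upwards [eventually_gt_atTop 0] with n hn
  have : (n : ℝ) ≠ 0 := by positivity
  rw [div_mul_cancel₀ _ this, blockSum, Finset.range_eq_Ico]

/-- A random walk with a drift in the direction `u` has infinitely many cut times at which the
functional `v`, along which there is no positive drift, is bounded above. -/
theorem ae_exists_frequently_isCutTime {ξ : ℕ → Ω → E} (hξ : ∀ i, Measurable (ξ i))
    (hindep : iIndepFun ξ μ) (hident : ∀ i, IdentDistrib (ξ i) (ξ 0) μ μ)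
    {u v : E → ℝ} (hu : Measurable u) (hv : Measurable v) {θ : ℝ} (hθ : 0 < θ)
    (hint : Integrable (fun ω => Real.exp (-θ * u (ξ 0 ω))) μ)
    (hmgf : mgf (fun ω => u (ξ 0 ω)) μ (-θ) < 1)
    (huint : Integrable (fun ω => u (ξ 0 ω)) μ) (hmean : 0 < ∫ ω, u (ξ 0 ω) ∂μ)
    (hvint : MemLp (fun ω => v (ξ 0 ω)) 2 μ) (hvmean : ∫ ω, v (ξ 0 ω) ∂μ ≤ 0)
    {e₀ : E} (he₀ : MeasurableSet {e₀}) (hue : u e₀ = 1) (hpos : 0 < μ (ξ 0 ⁻¹' {e₀})) :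
    ∀ᵐ ω ∂μ, ∃ C : ℝ, ∃ᶠ n in atTop, IsCutTime u ξ 0 n ω ∧ blockSum v ξ 0 n ω ≤ C := by
  -- The walk is restarted at time `K`, so that `T K` depends only on the steps from `K` on.
  let T : ℕ → Set Ω := fun K => {ω | ∃ C : ℝ, ∃ᶠ n in atTop,
    IsCutTime u ξ K n ω ∧ blockSum v ξ K n ω ≤ C}
  have hTm : ∀ K, MeasurableSet[⨆ i ∈ Set.Ici K, MeasurableSpace.comap (ξ i) inferInstance]
      (T K) := by
    intro K
    have heq : T K = ⋃ C : ℕ, ⋂ N : ℕ, ⋃ n : ℕ, ⋃ (_ : N ≤ n), ⋃ (_ : K ≤ n),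
        {ω | IsCutTime u ξ K n ω ∧ blockSum v ξ K n ω ≤ C} := by
      ext ω
      simp only [Set.mem_iUnion, Set.mem_iInter, exists_prop]
      constructor
      · rintro ⟨C, hC⟩
        obtain ⟨C', hC'⟩ := exists_nat_ge C
        refine ⟨C', fun N => ?_⟩
        obtain ⟨n, hn, h1, h2⟩ := frequently_atTop.1 hC (max N K)
        exact ⟨n, (le_max_left _ _).trans hn, (le_max_right _ _).trans hn, h1, h2.trans hC'⟩
      · rintro ⟨C, hC⟩
        refine ⟨C, frequently_atTop.2 fun N => ?_⟩
        obtain ⟨n, hn, -, h⟩ := hC N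
        exact ⟨n, hn, h⟩
    rw [heq]
    exact MeasurableSet.iUnion fun C => MeasurableSet.iInter fun N => MeasurableSet.iUnion fun n =>
      MeasurableSet.iUnion fun _ => MeasurableSet.iUnion fun hK =>
        measurableSet_isCutTime hu hv ξ K n hK C
  -- A later start removes conditions on cut times and shifts `v` by a finite amount. Hence the
  -- union over `K` is a tail event.
  have hTmono : Monotone T := by
    rintro K K' hKK ω ⟨C, hC⟩
    refine ⟨C - blockSum v ξ K K' ω, ?_⟩
    refine (hC.and_eventually (eventually_ge_atTop K')).mono fun n ⟨⟨⟨h1, h2⟩, h3⟩, h4⟩ => ?_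
    refine ⟨⟨fun m hm => h1 m (hKK.trans hm), h2⟩, ?_⟩
    have := blockSum_add v ξ hKK h4 ω
    linarith
  have htail : MeasurableSet[limsup (fun i => MeasurableSpace.comap (ξ i) inferInstance) atTop]
      (⋃ K, T K) := by
    rw [limsup_eq_iInf_iSup_of_nat, MeasurableSpace.measurableSet_iInf]
    intro N
    have heq : ⋃ K, T K = ⋃ K, T (K + N) :=
      Set.Subset.antisymm (Set.iUnion_mono fun K => hTmono (Nat.le_add_right K N))
        (Set.iUnion_subset fun K => Set.subset_iUnion T (K + N))
    rw [heq]
    refine MeasurableSet.iUnion fun K => ?_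
    refine (iSup₂_le fun i hi => ?_ : ⨆ i ∈ Set.Ici (K + N),
      MeasurableSpace.comap (ξ i) inferInstance ≤ _) _ (hTm (K + N))
    exact le_iSup₂_of_le (f := fun i _ => MeasurableSpace.comap (ξ i) inferInstance) i
      ((Nat.le_add_left N K).trans hi) le_rfl
  have hone : μ (⋃ K, T K) = 1 := by
    have hVi : iIndepFun (fun i ω => v (ξ i ω)) μ := hindep.comp (fun _ => v) fun _ => hv
    obtain ⟨c₀, hc₀, hc⟩ := exists_frequently_le_measure_sum_nonpos hVi
      (fun i => (hident i).comp hv) hvint hvmean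
    obtain ⟨C, hC⟩ := exists_infinite_cut_times_of_pos hξ hindep hident hu hv hθ hint hmgf hc₀
      (by simpa only [blockSum, Finset.range_eq_Ico] using hc) he₀ hue hpos
    refine (measure_zero_or_one_of_measurableSet_limsup_atTop (fun i => (hξ i).comap_le)
      hindep.iIndep htail).resolve_left fun h0 => ?_
    refine hC.ne' (measure_mono_null ?_ h0)
    exact fun ω hω => Set.mem_iUnion.2 ⟨0, C, hω⟩
  have hae : ∀ᵐ ω ∂μ, ω ∈ ⋃ K, T K :=
    (mem_ae_iff_prob_eq_one (MeasurableSet.iUnion fun K => iSup_comap_le hξ _ _ (hTm K))).2 hone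
  filter_upwards [hae, ae_tendsto_blockSum_atTop hindep hident hu huint hmean] with ω h1 h2
  obtain ⟨K, C, hC⟩ := Set.mem_iUnion.1 h1
  refine ⟨C + blockSum v ξ 0 K ω, ?_⟩
  -- The walk along `u` tends to infinity, so late cut times of the restarted walk also dominate its
  -- first `K` positions.
  have hev : ∀ᶠ n in atTop, ∀ m ∈ Finset.range K, blockSum u ξ 0 m ω ≤ blockSum u ξ 0 n ω :=
    (Finset.eventually_all _).2 fun m _ => h2.eventually_ge_atTop _
  refine (hC.and_eventually (hev.and (eventually_ge_atTop K))).mono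
    fun n ⟨⟨⟨h3, h4⟩, h5⟩, h6, h7⟩ => ⟨⟨fun m _ hm => ?_, h4⟩, ?_⟩
  · rcases le_or_gt K m with h | h
    · exact h3 m h hm
    · have := h6 m (Finset.mem_range.2 h)
      have := blockSum_add u ξ (Nat.zero_le m) hm ω
      linarith
  · have := blockSum_add v ξ (Nat.zero_le K) h7 ω
    linarith

end CutTimes
-- The walk on the full lattice: independence of its steps, and its cut times.
section LatticeWalk

open MeasureTheory ProbabilityTheory Filter Topology

variable {d : ℕ}

theorem sum_dir_eq (f : Dir d → ℝ) : ∑ e, f e = ∑ j, (f (j, 1) + f (j, -1)) := by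
  rw [Fintype.sum_prod_type]
  refine Finset.sum_congr rfl fun j _ => ?_
  rw [UnitsInt.univ, Finset.sum_pair (by decide)]

theorem exists_exp_sum_lt_one {p : Dir d → ℝ} (hp : ∀ e, 0 < p e) (hp1 : ∑ e, p e = 1)
    {j : Fin d} (hj : 0 < p (j, 1) - p (j, -1)) :
    ∃ θ : ℝ, 0 < θ ∧ ∑ e, p e * Real.exp (-θ * (e.vec j : ℝ)) < 1 := by
  have h1 := hp (j, 1)
  have h2 := hp (j, -1)
  have hlog : 0 < Real.log (p (j, 1) / p (j, -1)) :=
    Real.log_pos ((one_lt_div h2).2 (by linarith))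
  -- This `θ` balances the two tilted terms in coordinate `j`. With `t = exp θ` the sum falls short
  -- of one by exactly `p (j, -1) * (t - 1) ^ 2`.
  refine ⟨Real.log (p (j, 1) / p (j, -1)) / 2, by positivity, ?_⟩
  set θ := Real.log (p (j, 1) / p (j, -1)) / 2 with hθ
  set t := Real.exp θ with ht
  have ht1 : 1 < t := Real.one_lt_exp_iff.2 (by positivity)
  have ht2 : p (j, 1) = p (j, -1) * (t * t) := by
    rw [ht, ← Real.exp_add, hθ, add_halves, Real.exp_log (by positivity)]
    field_simp
  rw [← sub_neg, ← hp1, ← Finset.sum_sub_distrib, sum_dir_eq, Finset.sum_eq_single j]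
  · have hexp : Real.exp (-θ) = t⁻¹ := Real.exp_neg θ
    have : p (j, 1) * t⁻¹ = p (j, -1) * t := by
      rw [ht2]
      field_simp
    simp only [Dir.vec, Pi.single_eq_same, Units.val_one, Int.cast_one, mul_one, Units.val_neg,
      Int.cast_neg, mul_neg, neg_neg, hexp, this]
    rw [ht2]
    nlinarith [mul_pos h2 (mul_pos (sub_pos.2 ht1) (sub_pos.2 ht1))]
  · intro k _ hk
    simp [Dir.vec, Pi.single_eq_of_ne hk.symm]
  · simp

theorem stepProb_top {p : Dir d → ℝ} (hp1 : ∑ e, p e = 1) (x : Site d) (e : Dir d) :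
    stepProb p ⊤ x e = p e := by
  simp [stepProb, latticeGraph_adj_add_vec, hp1]

variable {Ω : Type*} {𝒢 mΩ : MeasurableSpace Ω} {μ : Measure Ω} [IsProbabilityMeasure μ]
  {p : Dir d → ℝ} {Y : ℕ → Ω → Site d}

/-- The steps of a lattice path. -/
def pathStep (Y : ℕ → Ω → Site d) (n : ℕ) (ω : Ω) : Site d := Y (n + 1) ω - Y n ω

theorem measurable_pathStep (hY : ∀ n, Measurable (Y n)) (n : ℕ) : Measurable (pathStep Y n) :=
  (hY _).sub (hY _)

theorem preimage_pathStep (Y : ℕ → Ω → Site d) (n : ℕ) (e : Dir d) :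
    pathStep Y n ⁻¹' {e.vec} = {ω | Y (n + 1) ω = Y n ω + e.vec} := by
  ext ω
  simp [pathStep, sub_eq_iff_eq_add, add_comm]

theorem IsRandomWalkOn.ae_pathStep_mem (h : IsRandomWalkOn μ p (fun _ => ⊤) 𝒢 Y)
    (hp : ∀ e, 0 < p e) (h𝒢 : 𝒢 ≤ mΩ) (hY : ∀ n, Measurable (Y n)) (e₀ : Dir d) :
    ∀ᵐ ω ∂μ, ∀ n, ∃ e : Dir d, pathStep Y n ω = e.vec := by
  have h0 : ∀ᵐ ω ∂μ, ∃ y, (⊤ : (latticeGraph d).Subgraph).Adj 0 y :=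
    Eventually.of_forall fun _ => ⟨_, latticeGraph_adj_add_vec 0 e₀⟩
  filter_upwards [h.ae_adj hp h𝒢 hY (fun x y => MeasurableSet.const _) h0] with ω hω n
  obtain ⟨e, he⟩ := exists_dir_of_adj (hω n).adj_sub
  exact ⟨e, by rw [pathStep, he, add_sub_cancel_left]⟩

theorem IsRandomWalkOn.measure_inter_pathStep (h : IsRandomWalkOn μ p (fun _ => ⊤) 𝒢 Y)
    (hp1 : ∑ e, p e = 1) (h𝒢 : 𝒢 ≤ mΩ) (hY : ∀ n, Measurable (Y n))
    {n : ℕ} (e : Dir d) {B : Set Ω} (hB : MeasurableSet[𝒢 ⊔ pastSigma Y n] B) :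
    μ (B ∩ pathStep Y n ⁻¹' {e.vec}) = μ B * ENNReal.ofReal (p e) := by
  have hm := sup_pastSigma_le hY h𝒢 n
  have h1 := h.integral_mul_step h𝒢 hY (n := n) e (g := B.indicator fun _ => (1 : ℝ))
    (measurable_const.indicator hB) (K := 1) (fun ω => by
      by_cases hω : ω ∈ B <;> simp [hω])
  simp only [stepProb_top hp1, integral_mul_const] at h1
  rw [integral_indicator_const _ (hm _ hB)] at h1
  have h2 : ∀ ω, B.indicator (fun _ => (1 : ℝ)) ω *
      Set.indicator {ω | Y (n + 1) ω = Y n ω + e.vec} (fun _ => (1 : ℝ)) ω =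
      (B ∩ pathStep Y n ⁻¹' {e.vec}).indicator (fun _ => (1 : ℝ)) ω := fun ω => by
    rw [preimage_pathStep]
    by_cases h1 : ω ∈ B <;> by_cases h2 : Y (n + 1) ω = Y n ω + e.vec <;>
      simp [Set.indicator, h1, h2]
  simp only [h2] at h1
  rw [integral_indicator_const _ ((hm _ hB).inter
    (measurable_pathStep hY n (measurableSet_singleton _)))] at h1
  simp only [smul_eq_mul, mul_one] at h1
  rw [← ofReal_measureReal, h1, ENNReal.ofReal_mul measureReal_nonneg, ofReal_measureReal]

theorem IsRandomWalkOn.measure_pathStep (h : IsRandomWalkOn μ p (fun _ => ⊤) 𝒢 Y)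
    (hp1 : ∑ e, p e = 1) (h𝒢 : 𝒢 ≤ mΩ) (hY : ∀ n, Measurable (Y n))
    (n : ℕ) (e : Dir d) : μ (pathStep Y n ⁻¹' {e.vec}) = ENNReal.ofReal (p e) := by
  have := h.measure_inter_pathStep hp1 h𝒢 hY (n := n) e MeasurableSet.univ
  simpa using this

/-- The state space is countable, so it suffices to compare two measures on singletons; those that
are not unit vectors are null. -/
theorem IsRandomWalkOn.measure_inter_preimage (h : IsRandomWalkOn μ p (fun _ => ⊤) 𝒢 Y)
    (hp : ∀ e, 0 < p e) (hp1 : ∑ e, p e = 1) (h𝒢 : 𝒢 ≤ mΩ) (hY : ∀ n, Measurable (Y n))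
    {n : ℕ} {B : Set Ω} (hB : MeasurableSet[𝒢 ⊔ pastSigma Y n] B) (A : Set (Site d)) (e₀ : Dir d) :
    μ (B ∩ pathStep Y n ⁻¹' A) = μ B * μ (pathStep Y n ⁻¹' A) := by
  have hm := sup_pastSigma_le hY h𝒢 n
  have hs := measurable_pathStep hY n
  have hA : MeasurableSet A := A.to_countable.measurableSet
  have heq : (μ.restrict B).map (pathStep Y n) = μ B • μ.map (pathStep Y n) := by
    refine Measure.ext_of_singleton fun x => ?_
    rw [Measure.map_apply hs (measurableSet_singleton x), Measure.smul_apply,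
      Measure.map_apply hs (measurableSet_singleton x),
      Measure.restrict_apply (hs (measurableSet_singleton x)), Set.inter_comm, smul_eq_mul]
    by_cases hx : ∃ e : Dir d, x = e.vec
    · obtain ⟨e, rfl⟩ := hx
      rw [h.measure_inter_pathStep hp1 h𝒢 hY e hB, h.measure_pathStep hp1 h𝒢 hY]
    · have h0 : μ (pathStep Y n ⁻¹' {x}) = 0 := by
        refine measure_eq_zero_iff_ae_notMem.2 ?_
        filter_upwards [h.ae_pathStep_mem hp h𝒢 hY e₀] with ω hω hωx
        obtain ⟨e, he⟩ := hω n
        exact hx ⟨e, hωx.symm.trans he⟩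
      rw [h0, mul_zero]
      exact measure_mono_null Set.inter_subset_right h0
  have := congrArg (fun ν : Measure (Site d) => ν A) heq
  simp only [Measure.smul_apply, smul_eq_mul] at this
  rwa [Measure.map_apply hs hA, Measure.map_apply hs hA, Measure.restrict_apply (hs hA),
    Set.inter_comm] at this

/-- Induction on the largest index: that step is independent of the past, which determines all the
earlier steps. -/
theorem IsRandomWalkOn.iIndepFun_pathStep (h : IsRandomWalkOn μ p (fun _ => ⊤) 𝒢 Y)
    (hp : ∀ e, 0 < p e) (hp1 : ∑ e, p e = 1) (h𝒢 : 𝒢 ≤ mΩ) (hY : ∀ n, Measurable (Y n))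
    (e₀ : Dir d) : iIndepFun (pathStep Y) μ := by
  refine iIndepFun_iff_measure_inter_preimage_eq_mul.2 fun S sets _ => ?_
  induction S using Finset.induction_on_max with
  | empty => simp
  | insert n S hn ih =>
    have hnS : n ∉ S := fun h' => lt_irrefl _ (hn n h')
    rw [Finset.set_biInter_insert, Finset.prod_insert hnS, Set.inter_comm,
      h.measure_inter_preimage hp hp1 h𝒢 hY ?_ _ e₀, ih fun i hi => ?_, mul_comm]
    · exact (sets i).to_countable.measurableSet
    · refine Finset.measurableSet_biInter _ fun i hi => ?_
      refine ((measurable_of_pastSigma (Nat.succ_le_of_lt (hn i hi)) 𝒢).sub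
        (measurable_of_pastSigma (hn i hi).le 𝒢)) ?_
      exact (sets i).to_countable.measurableSet

theorem IsRandomWalkOn.identDistrib_pathStep (h : IsRandomWalkOn μ p (fun _ => ⊤) 𝒢 Y)
    (hp : ∀ e, 0 < p e) (hp1 : ∑ e, p e = 1) (h𝒢 : 𝒢 ≤ mΩ) (hY : ∀ n, Measurable (Y n))
    (e₀ : Dir d) (n : ℕ) : IdentDistrib (pathStep Y n) (pathStep Y 0) μ μ := by
  refine ⟨(measurable_pathStep hY n).aemeasurable, (measurable_pathStep hY 0).aemeasurable,
    Measure.ext_of_singleton fun x => ?_⟩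
  rw [Measure.map_apply (measurable_pathStep hY n) (measurableSet_singleton x),
    Measure.map_apply (measurable_pathStep hY 0) (measurableSet_singleton x)]
  by_cases hx : ∃ e : Dir d, x = e.vec
  · obtain ⟨e, rfl⟩ := hx
    rw [h.measure_pathStep hp1 h𝒢 hY, h.measure_pathStep hp1 h𝒢 hY]
  · have h0 : ∀ n, μ (pathStep Y n ⁻¹' {x}) = 0 := fun n => by
      refine measure_eq_zero_iff_ae_notMem.2 ?_
      filter_upwards [h.ae_pathStep_mem hp h𝒢 hY e₀] with ω hω hωx
      obtain ⟨e, he⟩ := hω n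
      exact hx ⟨e, hωx.symm.trans he⟩
    rw [h0, h0]

theorem IsRandomWalkOn.memLp_pathStep (h : IsRandomWalkOn μ p (fun _ => ⊤) 𝒢 Y)
    (hp : ∀ e, 0 < p e) (h𝒢 : 𝒢 ≤ mΩ) (hY : ∀ n, Measurable (Y n)) (e₀ : Dir d)
    (f : Site d → ℝ) (q : ENNReal) : MemLp (fun ω => f (pathStep Y 0 ω)) q μ := by
  refine MemLp.of_bound
    (((Measurable.of_discrete (f := f)).comp (measurable_pathStep hY 0)).aestronglyMeasurable)
    (∑ e : Dir d, |f e.vec|) ?_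
  filter_upwards [h.ae_pathStep_mem hp h𝒢 hY e₀] with ω hω
  obtain ⟨e, he⟩ := hω 0
  rw [he, Real.norm_eq_abs]
  exact Finset.single_le_sum (f := fun e : Dir d => |f e.vec|) (fun e _ => abs_nonneg _)
    (Finset.mem_univ e)

theorem IsRandomWalkOn.integral_pathStep (h : IsRandomWalkOn μ p (fun _ => ⊤) 𝒢 Y)
    (hp : ∀ e, 0 < p e) (hp1 : ∑ e, p e = 1) (h𝒢 : 𝒢 ≤ mΩ) (hY : ∀ n, Measurable (Y n))
    (e₀ : Dir d) (f : Site d → ℝ) :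
    ∫ ω, f (pathStep Y 0 ω) ∂μ = ∑ e : Dir d, p e * f e.vec := by
  have hae : ∀ᵐ ω ∂μ, f (pathStep Y 0 ω) =
      ∑ e : Dir d, (pathStep Y 0 ⁻¹' {e.vec}).indicator (fun _ => f e.vec) ω := by
    filter_upwards [h.ae_pathStep_mem hp h𝒢 hY e₀] with ω hω
    obtain ⟨e, he⟩ := hω 0
    rw [Finset.sum_eq_single e]
    · simp [he]
    · intro e' _ hne
      refine Set.indicator_of_notMem (fun h' => hne ?_) _
      exact Dir.vec_injective (h'.symm.trans he)
    · simp
  have hms : ∀ e : Dir d, MeasurableSet (pathStep Y 0 ⁻¹' {e.vec}) := fun e =>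
    measurable_pathStep hY 0 (measurableSet_singleton _)
  rw [integral_congr_ae hae, integral_finsetSum _ fun e _ =>
    (integrable_const (f e.vec)).indicator (hms e)]
  refine Finset.sum_congr rfl fun e _ => ?_
  rw [integral_indicator_const _ (hms e), measureReal_def, h.measure_pathStep hp1 h𝒢 hY,
    ENNReal.toReal_ofReal (hp e).le, smul_eq_mul]

theorem blockSum_pathStep {f : Site d → ℝ} (hf : ∀ x y, f (x + y) = f x + f y)
    (Y : ℕ → Ω → Site d) {m n : ℕ} (hmn : m ≤ n) (ω : Ω) :
    blockSum f (pathStep Y) m n ω = f (Y n ω) - f (Y m ω) := by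
  rw [blockSum, ← Finset.sum_Ico_sub (fun i => f (Y i ω)) hmn]
  refine Finset.sum_congr rfl fun i _ => ?_
  have := hf (Y (i + 1) ω - Y i ω) (Y i ω)
  rw [sub_add_cancel] at this
  rw [pathStep]
  linarith

/-- A random walk on the lattice with a drift in the coordinate `j` has infinitely many cut times
at which `w · Y n` is bounded above, when the drift along `w` is nonpositive. -/
theorem IsRandomWalkOn.ae_exists_cut (h : IsRandomWalkOn μ p (fun _ => ⊤) 𝒢 Y)
    (hp : ∀ e, 0 < p e) (hp1 : ∑ e, p e = 1) (h𝒢 : 𝒢 ≤ mΩ) (hY : ∀ n, Measurable (Y n))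
    {j : Fin d} (hj : 0 < p (j, 1) - p (j, -1)) {w : Fin d → ℝ}
    (hw : ∑ k, w k * (p (k, 1) - p (k, -1)) ≤ 0) :
    ∀ᵐ ω ∂μ, ∃ C : ℝ, ∃ᶠ n in atTop, (∀ m ≤ n, Y m ω j ≤ Y n ω j) ∧
      (∀ m, n < m → Y n ω j < Y m ω j) ∧ siteDot w (Y n ω) ≤ C := by
  -- Only a witness that a direction exists: `have` forgets the value, so the forced step is written
  -- out as `(j, 1)` below.
  have e₀ : Dir d := (j, 1)
  obtain ⟨θ, hθ, hθ1⟩ := exists_exp_sum_lt_one hp hp1 hj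
  let u : Site d → ℝ := fun x => x j
  have hu : Measurable u := Measurable.of_discrete
  have hv : Measurable (siteDot w) := Measurable.of_discrete
  have huadd : ∀ x y, u (x + y) = u x + u y := fun x y => by simp [u]
  have hmeanu : ∫ ω, u (pathStep Y 0 ω) ∂μ = p (j, 1) - p (j, -1) := by
    rw [h.integral_pathStep hp hp1 h𝒢 hY e₀, sum_dir_eq, Finset.sum_eq_single j]
    · simp [u, Dir.vec]
      ring
    · intro k _ hk
      simp [u, Dir.vec, Pi.single_eq_of_ne hk.symm]
    · simp
  have hmeanv : ∫ ω, siteDot w (pathStep Y 0 ω) ∂μ ≤ 0 := by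
    rw [h.integral_pathStep hp hp1 h𝒢 hY e₀, sum_dir_eq]
    refine (Finset.sum_congr rfl fun k _ => ?_).trans_le hw
    simp [siteDot_vec]
    ring
  have key := ae_exists_frequently_isCutTime (measurable_pathStep hY)
    (h.iIndepFun_pathStep hp hp1 h𝒢 hY e₀) (h.identDistrib_pathStep hp hp1 h𝒢 hY e₀) hu hv hθ
    (memLp_one_iff_integrable.1
      (h.memLp_pathStep hp h𝒢 hY e₀ (fun x => Real.exp (-θ * u x)) 1))
    (by rwa [mgf, h.integral_pathStep hp hp1 h𝒢 hY e₀ fun x => Real.exp (-θ * u x)])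
    (memLp_one_iff_integrable.1 (h.memLp_pathStep hp h𝒢 hY e₀ u 1)) (hmeanu ▸ hj)
    (h.memLp_pathStep hp h𝒢 hY e₀ (siteDot w) 2) hmeanv
    (e₀ := Dir.vec (j, 1)) (measurableSet_singleton _) (by simp [u, Dir.vec])
    (by
      rw [h.measure_pathStep hp1 h𝒢 hY]
      exact ENNReal.ofReal_pos.2 (hp _))
  filter_upwards [key] with ω ⟨C, hC⟩
  refine ⟨C + siteDot w (Y 0 ω), hC.mono fun n ⟨⟨h1, h2⟩, h3⟩ => ⟨fun m hm => ?_, fun m hm => ?_, ?_⟩⟩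
  · have := h1 m (Nat.zero_le m) hm
    rw [blockSum_pathStep huadd Y hm] at this
    exact Int.cast_le.1 (sub_nonneg.1 this)
  · have := h2 m hm
    rw [blockSum_pathStep huadd Y hm.le] at this
    exact Int.cast_lt.1 (sub_pos.1 this)
  · rw [blockSum_pathStep (siteDot_add w) Y (Nat.zero_le n)] at h3
    linarith

end LatticeWalk
-- Cut edges of traces, and connectedness of decreasing intersections.
section Graphs

open MeasureTheory ProbabilityTheory Filter Topology

variable {d : ℕ}

theorem IsCut.mono {Z Z' : (latticeGraph d).Subgraph} {A : Finset (Site d)} {a b : Site d}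
    (h : IsCut Z A a b) (hZ : Z' ≤ Z) : IsCut Z' A a b :=
  ⟨h.left_mem, h.right_notMem, fun x hx y hy hxy => h.eq_of_adj x hx y hy (hZ.2 hxy)⟩

-- Coordinate `j` is at most `γ n j` on the sites visited up to time `n` and larger on all later
-- ones. So only the step made at time `n` can leave the past.
open Classical in
theorem isCut_traceGraph {γ : ℕ → Site d} {j : Fin d} {n : ℕ} (h1 : ∀ m ≤ n, γ m j ≤ γ n j)
    (h2 : ∀ m, n < m → γ n j < γ m j) :
    IsCut (traceGraph γ) ((Finset.range (n + 1)).image γ) (γ n) (γ (n + 1)) := by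
  have hle : ∀ x ∈ (Finset.range (n + 1)).image γ, x j ≤ γ n j := by
    intro x hx
    obtain ⟨m, hm, rfl⟩ := Finset.mem_image.1 hx
    exact h1 m (Nat.lt_succ_iff.1 (Finset.mem_range.1 hm))
  have hin : ∀ k, γ k ∈ (Finset.range (n + 1)).image γ → k ≤ n := fun k hk =>
    not_lt.1 fun hlt => not_lt.2 (hle _ hk) (h2 k hlt)
  have hout : ∀ k, γ k ∉ (Finset.range (n + 1)).image γ → n < k := fun k hk =>
    not_le.1 fun hle' => hk (Finset.mem_image_of_mem _ (Finset.mem_range.2 (by omega)))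
  refine ⟨Finset.mem_image_of_mem _ (by simp), fun h => ?_, ?_⟩
  · have := hin _ h
    omega
  · rintro x hx y hy ⟨-, k, hk⟩
    rcases Sym2.eq_iff.1 hk with ⟨rfl, rfl⟩ | ⟨rfl, rfl⟩
    · obtain rfl : k = n := by
        have := hin _ hx
        have := hout _ hy
        omega
      exact ⟨rfl, rfl⟩
    · have := hin _ hx
      have := hout _ hy
      omega

theorem reflTransGen_traceGraph {γ : ℕ → Site d} (h0 : γ 0 = 0)
    (h : ∀ n, (latticeGraph d).Adj (γ n) (γ (n + 1))) {x : Site d} (hx : x ∈ (traceGraph γ).verts) :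
    Relation.ReflTransGen (traceGraph γ).Adj 0 x := by
  obtain ⟨n, rfl⟩ := hx
  induction n with
  | zero => rw [h0]
  | succ n ih => exact ih.tail ⟨h n, n, rfl⟩

theorem traceGraph_le {γ : ℕ → Site d} {Z : (latticeGraph d).Subgraph}
    (h : ∀ n, Z.Adj (γ n) (γ (n + 1))) : traceGraph γ ≤ Z := by
  refine ⟨?_, ?_⟩
  · rintro _ ⟨n, rfl⟩
    exact (h n).fst_mem
  · rintro x y ⟨-, n, hn⟩
    rcases Sym2.eq_iff.1 hn with ⟨rfl, rfl⟩ | ⟨rfl, rfl⟩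
    · exact h n
    · exact (h n).symm

theorem IsCut.reflTransGen_inside {Z : (latticeGraph d).Subgraph} {A : Finset (Site d)}
    {a b o x : Site d} (h : IsCut Z A a b) (ho : o ∈ A) (hx : x ∈ A)
    (hox : Relation.ReflTransGen Z.Adj o x) :
    Relation.ReflTransGen (fun u v => Z.Adj u v ∧ u ∈ A ∧ v ∈ A) o x := by
  set R := Relation.ReflTransGen (fun u v => Z.Adj u v ∧ u ∈ A ∧ v ∈ A) o
  -- A path can leave and re-enter `A` only through the edge `a b`, so every excursion starts and
  -- ends at `a` and can be erased. The second clause remembers `a` during an excursion.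
  have key : (x ∈ A → R x) ∧ (x ∉ A → R a) := by
    clear hx
    induction hox with
    | refl => exact ⟨fun _ => Relation.ReflTransGen.refl, fun h' => absurd ho h'⟩
    | @tail u v _ huv ih =>
      by_cases hu : u ∈ A <;> by_cases hv : v ∈ A
      · exact ⟨fun _ => (ih.1 hu).tail ⟨huv, hu, hv⟩, fun h' => absurd hv h'⟩
      · obtain ⟨rfl, rfl⟩ := h.eq_of_adj u hu v hv huv
        exact ⟨fun h' => absurd h' hv, fun _ => ih.1 hu⟩
      · obtain ⟨rfl, rfl⟩ := h.eq_of_adj v hv u hu huv.symm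
        exact ⟨fun _ => ih.2 hu, fun h' => absurd hv h'⟩
      · exact ⟨fun h' => absurd h' hv, fun _ => ih.2 hu⟩
  exact key.1 hx

/-- Each pair either loses its edge at some index or keeps it forever, and `A` has finitely many
pairs. -/
theorem exists_stable_index {Z : ℕ → (latticeGraph d).Subgraph} (hZ : Antitone Z)
    (A : Finset (Site d)) : ∃ i, ∀ x ∈ A, ∀ y ∈ A, (Z i).Adj x y → (⨅ k, Z k).Adj x y := by
  classical
  have h : ∀ q : Site d × Site d, ∃ i, (Z i).Adj q.1 q.2 → (⨅ k, Z k).Adj q.1 q.2 := by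
    intro q
    by_contra! h
    exact (h 0).2 (SimpleGraph.Subgraph.iInf_adj.2 ⟨fun i => (h i).1, (h 0).1.adj_sub⟩)
  choose i hi using h
  refine ⟨(A ×ˢ A).sup i, fun x hx y hy hxy => hi (x, y) ((hZ ?_).2 hxy)⟩
  exact Finset.le_sup (f := i) (Finset.mk_mem_product hx hy)

/-- A decreasing intersection of connected graphs which are cut into finite pieces by single edges
is connected. -/
theorem iInf_connected {Z : ℕ → (latticeGraph d).Subgraph} (hZ : Antitone Z)
    (hconn : ∀ i, ∀ x ∈ (Z i).verts, Relation.ReflTransGen (Z i).Adj 0 x)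
    (hcut : ∀ x ∈ (Z 0).verts, ∃ A a b, IsCut (Z 0) A a b ∧ 0 ∈ A ∧ x ∈ A) {x : Site d}
    (hx : x ∈ (⨅ k, Z k).verts) : Relation.ReflTransGen (⨅ k, Z k).Adj 0 x := by
  have hxi : ∀ i, x ∈ (Z i).verts := fun i => (iInf_le Z i).1 hx
  obtain ⟨A, a, b, hA, h0, hxA⟩ := hcut x (hxi 0)
  obtain ⟨i, hi⟩ := exists_stable_index hZ A
  -- A path that stays inside `A` uses only edges which, from the stable index on, belong to the
  -- intersection.
  have hin := (hA.mono (hZ (Nat.zero_le i))).reflTransGen_inside h0 hxA (hconn i x (hxi i))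
  exact hin.lift id fun u v huv => hi u huv.2.1 v huv.2.2 huv.1

theorem iInf_exists_adj {Z : ℕ → (latticeGraph d).Subgraph} (hZ : Antitone Z)
    (h : ∀ i, ∃ y, (Z i).Adj 0 y) : ∃ y, (⨅ k, Z k).Adj 0 y := by
  obtain ⟨B, hB, hnbr⟩ := exists_neighbour_closed ({0} : Finset (Site d))
  obtain ⟨i, hi⟩ := exists_stable_index hZ B
  obtain ⟨y, hy⟩ := h i
  obtain ⟨e, rfl⟩ := exists_dir_of_adj hy.adj_sub
  exact ⟨_, hi 0 (hB (Finset.mem_singleton_self 0)) _ (hnbr 0 (Finset.mem_singleton_self 0) e) hy⟩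

theorem walkGraph_top (γ : ℕ∞ → ℕ → Site d) : walkGraph γ ⊤ = ⨅ i : ℕ, finiteGraph γ i := rfl

end Graphs

/-! ### The sequence of walks, its graphs, and the conclusion. -/

section WalkSequence

open MeasureTheory ProbabilityTheory Filter Topology

variable {d : ℕ} {Ω : Type*}

theorem measurable_of_earlierSigma (X : ℕ∞ → ℕ → Ω → Site d) {i j : ℕ} (h : j < i) (m : ℕ) :
    Measurable[earlierSigma X i] (X j m) := by
  refine Measurable.mono (comap_measurable (X j m)) ?_ le_rfl
  exact le_iSup₂_of_le (f := fun (j : ℕ) (_ : j < i) =>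
    ⨆ m : ℕ, MeasurableSpace.comap (X (j : ℕ∞) m) inferInstance) j h
    (le_iSup (fun m : ℕ => MeasurableSpace.comap (X (j : ℕ∞) m) inferInstance) m)

theorem measurableSet_finiteGraph_adj (X : ℕ∞ → ℕ → Ω → Site d) (i : ℕ) (x y : Site d) :
    MeasurableSet[earlierSigma X i] {ω | (finiteGraph (fun j n => X j n ω) i).Adj x y} := by
  cases i with
  | zero => exact MeasurableSet.const _
  | succ i =>
    have heq : {ω | (finiteGraph (fun j n => X j n ω) (i + 1)).Adj x y} =
        {_ω | (latticeGraph d).Adj x y} ∩ ⋃ n,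
          (X i n ⁻¹' {x} ∩ X i (n + 1) ⁻¹' {y}) ∪ (X i n ⁻¹' {y} ∩ X i (n + 1) ⁻¹' {x}) := by
      ext ω
      simp [finiteGraph, traceGraph]
    rw [heq]
    have hm := fun n => measurable_of_earlierSigma X (Nat.lt_succ_self i) n
    refine (MeasurableSet.const _).inter (MeasurableSet.iUnion fun n => ?_)
    exact ((hm n (measurableSet_singleton x)).inter (hm (n + 1) (measurableSet_singleton y))).union
      ((hm n (measurableSet_singleton y)).inter (hm (n + 1) (measurableSet_singleton x)))

theorem measurableSet_finiteGraph_verts (X : ℕ∞ → ℕ → Ω → Site d) (i : ℕ) (x : Site d) :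
    MeasurableSet[earlierSigma X i] {ω | x ∈ (finiteGraph (fun j n => X j n ω) i).verts} := by
  cases i with
  | zero => exact MeasurableSet.const _
  | succ i =>
    have heq : {ω | x ∈ (finiteGraph (fun j n => X j n ω) (i + 1)).verts} =
        ⋃ n, X i n ⁻¹' {x} := by
      ext ω
      simp [finiteGraph, traceGraph]
    rw [heq]
    exact MeasurableSet.iUnion fun n =>
      measurable_of_earlierSigma X (Nat.lt_succ_self i) n (measurableSet_singleton x)

variable [mΩ : MeasurableSpace Ω] {μ : Measure Ω} {p : ℕ∞ → Dir d → ℝ}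
  {X : ℕ∞ → ℕ → Ω → Site d}

theorem earlierSigma_le (hX : IsWalkSequence μ p X) (i : ℕ) : earlierSigma X i ≤ mΩ :=
  iSup₂_le fun j _ => iSup_le fun m => (hX.measurable j m).comap_le

theorem graphSigma_walkGraph_top_le (hX : IsWalkSequence μ p X) :
    graphSigma (fun ω => walkGraph (fun j n => X j n ω) ⊤) ≤ mΩ := by
  refine MeasurableSpace.generateFrom_le ?_
  rintro _ (⟨x, rfl⟩ | ⟨x, y, rfl⟩)
  · have heq : {ω | x ∈ (walkGraph (fun j n => X j n ω) ⊤).verts} =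
        ⋂ i, {ω | x ∈ (finiteGraph (fun j n => X j n ω) i).verts} := by
      ext ω
      simp [walkGraph_top]
    rw [heq]
    exact MeasurableSet.iInter fun i =>
      earlierSigma_le hX i _ (measurableSet_finiteGraph_verts X i x)
  · have heq : {ω | (walkGraph (fun j n => X j n ω) ⊤).Adj x y} =
        {_ω | (latticeGraph d).Adj x y} ∩
          ⋂ i, {ω | (finiteGraph (fun j n => X j n ω) i).Adj x y} := by
      ext ω
      simp [walkGraph_top, and_comm]
    rw [heq]
    exact (MeasurableSet.const _).inter (MeasurableSet.iInter fun i =>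
      earlierSigma_le hX i _ (measurableSet_finiteGraph_adj X i x y))

/-- Induction on `i`: the first edge used by one walk gives the next graph an edge at the origin, so
the next walk is not stuck there. -/
theorem IsWalkSequence.ae_adj [IsProbabilityMeasure μ] (hX : IsWalkSequence μ p X) (hp : ∀ i e, 0 < p i e) (e₀ : Dir d)
    (i : ℕ) :
    ∀ᵐ ω ∂μ, X i 0 ω = 0 ∧
      ∀ n, (finiteGraph (fun j n => X j n ω) i).Adj (X i n ω) (X i (n + 1) ω) := by
  have key : ∀ i : ℕ, (∀ᵐ ω ∂μ, ∃ y, (finiteGraph (fun j n => X j n ω) i).Adj 0 y) →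
      ∀ᵐ ω ∂μ, X i 0 ω = 0 ∧
        ∀ n, (finiteGraph (fun j n => X j n ω) i).Adj (X i n ω) (X i (n + 1) ω) := fun i h =>
    (hX.finite_walk i).start.and ((hX.finite_walk i).ae_adj (hp i) (earlierSigma_le hX i)
      (hX.measurable i) (measurableSet_finiteGraph_adj X i) h)
  induction i with
  | zero => exact key 0 (Eventually.of_forall fun _ => ⟨_, latticeGraph_adj_add_vec 0 e₀⟩)
  | succ i ih =>
    refine key (i + 1) ?_
    filter_upwards [ih] with ω ⟨h0, h⟩
    exact ⟨X i 1 ω, (h0 ▸ h 0).adj_sub, 0, by simp only [h0, zero_add]⟩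

theorem antitone_finiteGraph {γ : ℕ∞ → ℕ → Site d}
    (h : ∀ (i : ℕ) n, (finiteGraph γ i).Adj (γ i n) (γ i (n + 1))) : Antitone (finiteGraph γ) :=
  antitone_nat_of_succ_le fun i => traceGraph_le (h i)

theorem finiteGraph_connected {γ : ℕ∞ → ℕ → Site d} (h0 : ∀ i : ℕ, γ i 0 = 0)
    (h : ∀ (i : ℕ) n, (finiteGraph γ i).Adj (γ i n) (γ i (n + 1))) (i : ℕ) {x : Site d}
    (hx : x ∈ (finiteGraph γ (i + 1)).verts) :
    Relation.ReflTransGen (finiteGraph γ (i + 1)).Adj 0 x :=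
  reflTransGen_traceGraph (h0 i) (fun n => (h i n).adj_sub) hx

/-- Dropping the full lattice makes the first graph of the decreasing family a trace, which has cut
edges. -/
theorem walkGraph_top_eq {γ : ℕ∞ → ℕ → Site d}
    (h : ∀ (i : ℕ) n, (finiteGraph γ i).Adj (γ i n) (γ i (n + 1))) :
    walkGraph γ ⊤ = ⨅ i : ℕ, finiteGraph γ (i + 1) := by
  refine le_antisymm (le_iInf fun i => iInf_le (finiteGraph γ) (i + 1)) (le_iInf fun i => ?_)
  exact (iInf_le (fun i => finiteGraph γ (i + 1)) i).trans
    (antitone_finiteGraph h (Nat.le_succ i))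

/-- The graphs `Z^(i)` with `i ≥ 1` are connected subgraphs of the trace of the first walk when
that trace is cut into finite pieces by single edges. -/
theorem walkGraph_connected {γ : ℕ∞ → ℕ → Site d} (h0 : ∀ i : ℕ, γ i 0 = 0)
    (h : ∀ (i : ℕ) n, (finiteGraph γ i).Adj (γ i n) (γ i (n + 1)))
    (hcut : ∀ x ∈ (traceGraph (γ 0)).verts, ∃ A a b, IsCut (traceGraph (γ 0)) A a b ∧ 0 ∈ A ∧ x ∈ A)
    {i : ℕ∞} (hi : 1 ≤ i) :
    walkGraph γ i ≤ traceGraph (γ 0) ∧ (∃ y, (walkGraph γ i).Adj 0 y) ∧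
      ∀ x ∈ (walkGraph γ i).verts, Relation.ReflTransGen (walkGraph γ i).Adj 0 x := by
  have hanti := antitone_finiteGraph h
  have hadj : ∀ i : ℕ, ∃ y, (finiteGraph γ (i + 1)).Adj 0 y := fun i =>
    ⟨γ i 1, (h0 i ▸ h i 0).adj_sub, 0, by rw [h0 i]⟩
  cases i with
  | top =>
    rw [walkGraph_top_eq h]
    have hanti' : Antitone fun i : ℕ => finiteGraph γ (i + 1) := fun a b hab =>
      hanti (Nat.add_le_add_right hab 1)
    exact ⟨iInf_le (fun i : ℕ => finiteGraph γ (i + 1)) 0, iInf_exists_adj hanti' hadj,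
      fun x hx => iInf_connected hanti' (fun i x hx => finiteGraph_connected h0 h i hx) hcut hx⟩
  | coe i =>
    obtain ⟨k, rfl⟩ : ∃ k, i = k + 1 :=
      ⟨i - 1, by have : 1 ≤ i := by exact_mod_cast hi
                 omega⟩
    exact ⟨hanti (Nat.le_add_left 1 k), hadj k, fun x hx => finiteGraph_connected h0 h k hx⟩

theorem sum_ellHat_mul_drift_nonpos {q r : Dir d → ℝ} (h : inner ℝ (drift q) (ell r) ≤ 0) :
    ∑ k, ellHat r k * (q (k, 1) - q (k, -1)) ≤ 0 := by
  have heq : inner ℝ (drift q) (ellHat r) = ∑ k, ellHat r k * (q (k, 1) - q (k, -1)) := by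
    simp [PiLp.inner_apply, drift]
  rw [← heq]
  rcases eq_or_ne (ellHat r) 0 with h0 | h0
  · rw [h0, inner_zero_right]
  · rw [ell, inner_smul_right] at h
    have : 0 < ‖ellHat r‖⁻¹ := inv_pos.2 (norm_pos_iff.2 h0)
    by_contra! hpos
    exact absurd h (not_le.2 (mul_pos this hpos))

/-- If the trace of the first walk has infinitely many cut times at which the weights of the
`i`th walk are bounded, then the `i`th walk has hitting probabilities equal to one. -/
theorem tendsto_hitProb_walkGraph {γ : ℕ∞ → ℕ → Site d} {q : Dir d → ℝ} (hq : ∀ e, 0 < q e)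
    (hq1 : ∑ e, q e = 1) (h0 : ∀ i : ℕ, γ i 0 = 0)
    (h : ∀ (i : ℕ) n, (finiteGraph γ i).Adj (γ i n) (γ i (n + 1))) {j : Fin d} {C : ℝ}
    (hC : ∃ᶠ n in atTop, (∀ m ≤ n, γ 0 m j ≤ γ 0 n j) ∧ (∀ m, n < m → γ 0 n j < γ 0 m j) ∧
      siteDot (ellHat q) (γ 0 n) ≤ C) {i : ℕ∞} (hi : 1 ≤ i) :
    (∃ y, (walkGraph γ i).Adj 0 y) ∧ ∀ z ∈ (walkGraph γ i).verts, ∀ x ∈ (walkGraph γ i).verts,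
      Tendsto (fun N => hitProb q (walkGraph γ i) z N x) atTop (𝓝 1) := by
  classical
  have hγ0 : γ 0 0 = 0 := by exact_mod_cast h0 0
  have hcut : ∀ x ∈ (traceGraph (γ 0)).verts,
      ∃ A a b, IsCut (traceGraph (γ 0)) A a b ∧ 0 ∈ A ∧ x ∈ A := by
    rintro _ ⟨m, rfl⟩
    obtain ⟨n, hn, h1, h2, -⟩ := frequently_atTop.1 hC m
    refine ⟨_, _, _, isCut_traceGraph h1 h2, ?_, Finset.mem_image_of_mem _ (by simp; omega)⟩
    exact hγ0 ▸ Finset.mem_image_of_mem _ (by simp)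
  obtain ⟨hle, hadj, hconn⟩ := walkGraph_connected h0 h hcut hi
  refine ⟨hadj, fun z hz x hx => ?_⟩
  refine tendsto_hitProb_one hq hadj hconn (Nat.frequently_atTop_iff_infinite.1 hC)
    (A := fun n => (Finset.range (n + 1)).image (γ 0)) (a := fun n => γ 0 n)
    (b := fun n => γ 0 (n + 1)) (fun n hn => (isCut_traceGraph hn.1 hn.2.1).mono hle) ?_ ?_
    (M := Real.exp C) (fun n hn => ?_) hz hx
  -- Distinct cut times have distinct sites, because the walk strictly exceeds its `j`-coordinate
  -- after a cut time.
  · intro m hm n hn hmn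
    dsimp only at hmn
    rcases lt_trichotomy m n with hlt | heq | hlt
    · exact absurd (hm.2.1 n hlt) (by rw [hmn]; exact lt_irrefl _)
    · exact heq
    · exact absurd (hn.2.1 m hlt) (by rw [hmn]; exact lt_irrefl _)
  · intro z hz
    obtain ⟨m, rfl⟩ := hle.1 hz
    exact ⟨m, fun n _ hn => Finset.mem_image_of_mem _ (by simp; omega)⟩
  · exact (conductance_le hq hq1 _ _ _).trans (Real.exp_le_exp.2 hn.2.2)

end WalkSequence

theorem mainTheorem4 {Ω : Type*} [MeasurableSpace Ω] (μ : MeasureTheory.Measure Ω)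
    [MeasureTheory.IsProbabilityMeasure μ] (d : ℕ) (hd : 2 ≤ d)
    (p : ℕ∞ → Dir d → ℝ) (hp : ∀ i, p i ∈ stdSimplex ℝ (Dir d))
    (X : ℕ∞ → ℕ → Ω → Site d) (hX : IsWalkSequence μ p X)
    (ha : ∀ j, 0 ≤ drift (p 0) j) (ha' : 0 < drift (p 0) ⟨0, by omega⟩)
    (hb : ∀ i e, 0 < p i e)
    (i : ℕ∞) (hi : 1 ≤ i) (hc : inner ℝ (drift (p 0)) (ell (p i)) ≤ 0) :
    IsRecurrentOn μ (fun ω => walkGraph (fun j n => X j n ω) i) (X i) := by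
  -- The graph with index zero is the full lattice by definition, so the results on lattice walks
  -- apply to `X 0`.
  have hcut := (show IsRandomWalkOn μ (p 0) (fun _ => ⊤) (earlierSigma X 0) (X 0) from
    hX.finite_walk 0).ae_exists_cut (hb 0) (hp 0).2 (earlierSigma_le hX 0) (hX.measurable 0)
      (j := ⟨0, by omega⟩) ha' (sum_ellHat_mul_drift_nonpos hc)
  have hadj := MeasureTheory.ae_all_iff.2 (hX.ae_adj hb (⟨0, by omega⟩, 1))
  have hgood : ∀ᵐ ω ∂μ, (∃ y, (walkGraph (fun j n => X j n ω) i).Adj 0 y) ∧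
      ∀ z ∈ (walkGraph (fun j n => X j n ω) i).verts,
      ∀ x ∈ (walkGraph (fun j n => X j n ω) i).verts,
      Filter.Tendsto (fun N => hitProb (p i) (walkGraph (fun j n => X j n ω) i) z N x)
        Filter.atTop (nhds 1) := by
    filter_upwards [hcut, hadj] with ω ⟨C, hC⟩ h
    exact tendsto_hitProb_walkGraph (hb i) (hp i).2 (fun k => (h k).1) (fun k => (h k).2) hC hi
  have h0 := hgood.mono fun _ h => h.1
  have hhit := hgood.mono fun _ h => h.2
  cases i with
  | top =>
    refine hX.infinite_walk.isRecurrentOn (hb ⊤) (graphSigma_walkGraph_top_le hX)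
      (hX.measurable ⊤) (fun x y => ?_) (fun x => ?_) h0 hhit
    · exact MeasurableSpace.measurableSet_generateFrom (Or.inr ⟨x, y, rfl⟩)
    · exact MeasurableSpace.measurableSet_generateFrom (Or.inl ⟨x, rfl⟩)
  | coe k =>
    exact (hX.finite_walk k).isRecurrentOn (hb k) (earlierSigma_le hX k) (hX.measurable k)
      (measurableSet_finiteGraph_adj X k) (measurableSet_finiteGraph_verts X k) h0 hhit
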